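/- Let $\psi:\mathbb S^3(\sqrt2)\to\mathbb S^2(1/\sqrt2)$ be the Hopf map $\psi(z,w)=\frac1{2\sqrt2}\,(2z\overline w,\ |z|^2-|w|^2)$, with $z=x^1+\mathrm i x^2$, $w=x^3+\mathrm i x^4$. On $\mathbb S^3(\sqrt2)$ consider the orthonormal frame $$X_1=\tfrac1{\sqrt2}(-x^2,x^1,-x^4,x^3),\quad X_2=\tfrac1{\sqrt2}(-x^3,x^4,x^1,-x^2),\quad X_3=\tfrac1{\sqrt2}(-x^4,-x^3,x^2,x^1),$$ where $X_1$ spans the tangent spaces of the fibres. Let $\Delta=-\operatorname{trace}\nabla d$ be the Laplacian on $C^\infty(\mathbb S^3(\sqrt2))$ (real functions), and let $\Delta^V$ be the vertical Laplacian: $(\Delta^Vf)(p)$ is the value at $p$ of the Laplacian of the fibre $\psi^{-1}(\psi(p))$ applied to the restriction of $f$ to this fibre. Let $$J^\psi V=-\operatorname{trace}(\nabla^\psi)^2V+\operatorname{trace}R(d\psi\,\cdot,V)d\psi\,\cdot$$ be the Jacobi operator on smooth sections $V$ of $\psi^{-1}T\mathbb S^2(1/\sqrt2)$, where $\nabla^\psi$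 is the pull-back connection and $R(X,Y)=[\nabla_X,\nabla_Y]-\nabla_{[X,Y]}$ is the curvature of $\mathbb S^2(1/\sqrt2)$. For $k\in\mathbb N=\{0,1,2,\dots\}$ put $\lambda_k=\frac{k(k+2)}2$, $E_k=\{f\in C^\infty(\mathbb S^3(\sqrt2)):\Delta f=\lambda_kf\}$ and $$S^\psi_{\lambda_k}=\{f_2\,d\psi(X_2):f_2\in E_k\}\oplus\{f_3\,d\psi(X_3):f_3\in E_k\}.$$ **Proposition 4.3.** For every $k\in\mathbb N$, $\Delta^V$ maps $E_k$ into itself and $J^\psi$ maps $S^\psi_{\lambda_k}$ into itself. The eigenvalues $c$ of $\Delta^V|_{E_k}$ satisfy $c\ge0$, and the eigenvalues of $J^\psi|_{S^\psi_{\lambda_k}}$ are exactly the numbers $\lambda_k\pm2\sqrt{2c}$, where $c$ runs over the eigenvalues of $\Delta^V|_{E_k}$ and both signs occur. The eigensections are as follows. * A section $V$ belongs to $S^\psi_{\lambda_k}$ and satisfies $J^\psi V=\lambda_kV$ if and only if $V=f_2\,d\psi(X_2)+f_3\,d\psi(X_3)$ for some $f_2,f_3\in E_k$ with $X_1f_2=X_1f_3=0$.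 * For every real $c>0$ and each choice of the sign $\pm$, a section $V$ belongs to $S^\psi_{\lambda_k}$ and satisfies $J^\psi V=(\lambda_k\pm2\sqrt{2c})V$ if and only if $V=f\,d\psi(X_2)\pm\frac1{\sqrt c}(X_1f)\,d\psi(X_3)$ for some $f\in E_k$ with $\Delta^Vf=cf$. Each eigenvalue of $J^\psi|_{S^\psi_{\lambda_k}}$ has multiplicity $2(k+1)$, that is, its eigenspace in $S^\psi_{\lambda_k}$ has real dimension $2(k+1)$. -/

import Mathlib

open scoped ContDiff RealInnerProductSpace
open Metric

noncomputable section

set_option linter.unusedSectionVars false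

namespace HopfJacobi

/-! ### Calculus on the round sphere of radius `r` about the origin -/

section Sphere

variable {E : Type*} [NormedAddCommGroup E] [InnerProductSpace ℝ E]
variable {F : Type*} [NormedAddCommGroup F] [NormedSpace ℝ F]
variable {r : ℝ}

open Classical in
/-- The extension of a map on the sphere of radius `r` that is constant along rays from the origin:
`y ↦ f (r y / ‖y‖)` for `y ≠ 0` (the value at `0` is irrelevant). -/
def radialExt (f : sphere (0 : E) r → F) (y : E) : F :=
  if h : (r / ‖y‖) • y ∈ sphere (0 : E) r then f ⟨(r / ‖y‖) • y, h⟩ else 0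

/-- A map on the sphere is smooth when its radial extension is smooth off the origin.
As the inclusion of the sphere and the radial projection onto it are smooth, this is smoothness
for the submanifold structure of the sphere. -/
def IsSmooth (f : sphere (0 : E) r → F) : Prop :=
  ContDiffOn ℝ ∞ (radialExt f) {0}ᶜ

/-- The derivative `X f` of a (vector valued) function `f` on the sphere along the tangent vector
field `X`, vector fields being viewed as maps into the ambient Euclidean space. -/
def along (X : sphere (0 : E) r → E) (f : sphere (0 : E) r → F) (x : sphere (0 : E) r) : F :=
  fderiv ℝ (radialExt f) x (X x)

/-- The orthogonal projection of the ambient space onto the tangent space `p^⊥` at `p`. -/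
def tanProj (p v : E) : E := v - (⟪p, v⟫ / ⟪p, p⟫) • p

/-- The Levi-Civita connection `∇_X Y` of the sphere: the tangential part of the derivative of `Y`
along `X` in the ambient Euclidean space. -/
def leviCivita (X Y : sphere (0 : E) r → E) (x : sphere (0 : E) r) : E :=
  tanProj (x : E) (along X Y x)

/-- The Lie bracket `[X, Y]` of tangent vector fields on the sphere. -/
def bracket (X Y : sphere (0 : E) r → E) : sphere (0 : E) r → E :=
  along X Y - along Y X

/-- `R(X, Y) Z = ∇_X ∇_Y Z - ∇_Y ∇_X Z - ∇_{[X, Y]} Z` for tangent vector fields on the sphere. -/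
def curvature (X Y Z : sphere (0 : E) r → E) : sphere (0 : E) r → E :=
  leviCivita X (leviCivita Y Z) - leviCivita Y (leviCivita X Z) - leviCivita (bracket X Y) Z

/-- An extension of a tangent vector `u` at a point of the sphere to a tangent vector field. -/
def extend (r : ℝ) (u : E) (x : sphere (0 : E) r) : E := tanProj (x : E) u

/-- The value `R_y(u, v) w` of the curvature tensor of the sphere on tangent vectors at `y`,
computed with extensions of `u`, `v`, `w` to vector fields. -/
def curvatureAt (y : sphere (0 : E) r) (u v w : E) : E :=
  curvature (extend r u) (extend r v) (extend r w) y

/-! Basic facts -/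

lemma ne_zero_of_mem (hr : 0 < r) (x : sphere (0 : E) r) : (x : E) ≠ 0 := by
  intro h
  have := mem_sphere_zero_iff_norm.1 x.2
  rw [h, norm_zero] at this
  exact hr.ne this

lemma inner_self_mem (x : sphere (0 : E) r) : ⟪(x : E), (x : E)⟫ = r ^ 2 := by
  rw [real_inner_self_eq_norm_sq, mem_sphere_zero_iff_norm.1 x.2]

lemma proj_mem (hr : 0 < r) {y : E} (hy : y ≠ 0) : (r / ‖y‖) • y ∈ sphere (0 : E) r := by
  rw [mem_sphere_zero_iff_norm, norm_smul, Real.norm_of_nonneg (by positivity)]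
  field_simp [norm_ne_zero_iff.2 hy]

lemma radialExt_apply (hr : 0 < r) (f : sphere (0 : E) r → F) {y : E} (hy : y ≠ 0) :
    radialExt f y = f ⟨(r / ‖y‖) • y, proj_mem hr hy⟩ := dif_pos (proj_mem hr hy)

lemma proj_coe (hr : 0 < r) (x : sphere (0 : E) r) : (r / ‖(x : E)‖) • (x : E) = x := by
  rw [mem_sphere_zero_iff_norm.1 x.2, div_self hr.ne', one_smul]

lemma radialExt_coe (hr : 0 < r) (f : sphere (0 : E) r → F) (x : sphere (0 : E) r) :
    radialExt f x = f x := by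
  rw [radialExt_apply hr f (ne_zero_of_mem hr x)]
  exact congrArg f (Subtype.ext (proj_coe hr x))

lemma contDiffOn_proj : ContDiffOn ℝ ∞ (fun y : E => (r / ‖y‖) • y) {0}ᶜ := by
  intro y hy
  have hy' : y ≠ 0 := hy
  have := (contDiffAt_norm ℝ (n := ∞) hy')
  exact ((contDiffAt_const.div this (norm_ne_zero_iff.2 hy')).smul contDiffAt_id).contDiffWithinAt

lemma isSmooth_of_contDiffOn (hr : 0 < r) {f : sphere (0 : E) r → F} {g : E → F}
    (hg : ContDiffOn ℝ ∞ g {0}ᶜ) (h : ∀ x, f x = g x) : IsSmooth f := by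
  have h1 : ContDiffOn ℝ ∞ (fun y : E => g ((r / ‖y‖) • y)) {0}ᶜ := by
    refine hg.comp contDiffOn_proj ?_
    intro y hy
    exact ne_zero_of_mem hr ⟨_, proj_mem hr hy⟩
  refine h1.congr ?_
  intro y hy
  rw [radialExt_apply hr f hy, h]

lemma IsSmooth.contDiffAt {f : sphere (0 : E) r → F} (hf : IsSmooth f) {y : E} (hy : y ≠ 0) :
    ContDiffAt ℝ ∞ (radialExt f) y :=
  ContDiffOn.contDiffAt hf (isOpen_compl_singleton.mem_nhds hy)

lemma IsSmooth.differentiableAt (hr : 0 < r) {f : sphere (0 : E) r → F} (hf : IsSmooth f)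
    (x : sphere (0 : E) r) : DifferentiableAt ℝ (radialExt f) x :=
  (hf.contDiffAt (ne_zero_of_mem hr x)).differentiableAt (by simp)

lemma radialExt_add (f g : sphere (0 : E) r → F) :
    radialExt (f + g) = radialExt f + radialExt g := by
  funext y
  simp only [radialExt, Pi.add_apply]
  split_ifs <;> simp

lemma radialExt_smul (c : ℝ) (f : sphere (0 : E) r → F) :
    radialExt (c • f) = c • radialExt f := by
  funext y
  simp only [radialExt, Pi.smul_apply]
  split_ifs <;> simp

lemma IsSmooth.add {f g : sphere (0 : E) r → F} (hf : IsSmooth f) (hg : IsSmooth g) :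
    IsSmooth (f + g) := by
  unfold IsSmooth
  rw [radialExt_add]
  exact ContDiffOn.add hf hg

lemma IsSmooth.const_smul {f : sphere (0 : E) r → F} (c : ℝ) (hf : IsSmooth f) :
    IsSmooth (c • f) := by
  unfold IsSmooth
  rw [radialExt_smul]
  exact ContDiffOn.const_smul c hf

lemma isSmooth_zero : IsSmooth (0 : sphere (0 : E) r → F) := by
  have h : radialExt (0 : sphere (0 : E) r → F) = fun _ => 0 := by
    funext y
    simp [radialExt]
  unfold IsSmooth
  rw [h]
  exact contDiffOn_const

lemma IsSmooth.neg {f : sphere (0 : E) r → F} (hf : IsSmooth f) : IsSmooth (-f) := by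
  have := hf.const_smul (-1)
  rwa [neg_one_smul] at this

lemma IsSmooth.sub {f g : sphere (0 : E) r → F} (hf : IsSmooth f) (hg : IsSmooth g) :
    IsSmooth (f - g) := by
  rw [sub_eq_add_neg]
  exact hf.add hg.neg

lemma IsSmooth.sum {ι : Type*} (s : Finset ι) {f : ι → sphere (0 : E) r → F}
    (hf : ∀ i, IsSmooth (f i)) : IsSmooth (∑ i ∈ s, f i) :=
  Finset.sum_induction _ IsSmooth (fun _ _ => IsSmooth.add) isSmooth_zero (fun i _ => hf i)

lemma IsSmooth.smul (hr : 0 < r) {f : sphere (0 : E) r → ℝ} {g : sphere (0 : E) r → F}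
    (hf : IsSmooth f) (hg : IsSmooth g) : IsSmooth (fun x => f x • g x) := by
  have h : ContDiffOn ℝ ∞ (fun y => radialExt f y • radialExt g y) {0}ᶜ := ContDiffOn.smul hf hg
  refine h.congr fun y hy => ?_
  rw [radialExt_apply hr _ hy, radialExt_apply hr _ hy, radialExt_apply hr _ hy]

lemma IsSmooth.inner {G : Type*} [NormedAddCommGroup G] [InnerProductSpace ℝ G] (hr : 0 < r)
    {f g : sphere (0 : E) r → G} (hf : IsSmooth f) (hg : IsSmooth g) :
    IsSmooth (fun x => ⟪f x, g x⟫) := by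
  have h : ContDiffOn ℝ ∞ (fun y => ⟪radialExt f y, radialExt g y⟫) {0}ᶜ :=
    ContDiffOn.inner ℝ hf hg
  refine h.congr fun y hy => ?_
  rw [radialExt_apply hr _ hy, radialExt_apply hr _ hy, radialExt_apply hr _ hy]

lemma isSmooth_coe (hr : 0 < r) : IsSmooth (fun x : sphere (0 : E) r => (x : E)) :=
  isSmooth_of_contDiffOn hr (g := fun y => y) contDiffOn_id fun _ => rfl

lemma IsSmooth.along (hr : 0 < r) {X : sphere (0 : E) r → E} {f : sphere (0 : E) r → F}
    (hX : IsSmooth X) (hf : IsSmooth f) : IsSmooth (along X f) := by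
  have h1 : ContDiffOn ℝ ∞ (fderiv ℝ (radialExt f)) {0}ᶜ :=
    ContDiffOn.fderiv_of_isOpen hf isOpen_compl_singleton (by simp)
  have h2 : ContDiffOn ℝ ∞ (fun y : E => fderiv ℝ (radialExt f) ((r / ‖y‖) • y)) {0}ᶜ := by
    refine h1.comp contDiffOn_proj ?_
    intro y hy
    exact ne_zero_of_mem hr ⟨_, proj_mem hr hy⟩
  refine (h2.clm_apply hX).congr fun y hy => ?_
  rw [radialExt_apply hr _ hy, radialExt_apply hr _ hy]
  rfl

lemma along_add (hr : 0 < r) (X : sphere (0 : E) r → E) {f g : sphere (0 : E) r → F}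
    (hf : IsSmooth f) (hg : IsSmooth g) : along X (f + g) = along X f + along X g := by
  funext x
  simp only [along, radialExt_add, Pi.add_apply]
  rw [fderiv_add (hf.differentiableAt hr x) (hg.differentiableAt hr x)]
  rfl

lemma along_smul (hr : 0 < r) (X : sphere (0 : E) r → E) (c : ℝ) {f : sphere (0 : E) r → F}
    (hf : IsSmooth f) : along X (c • f) = c • along X f := by
  funext x
  simp only [along, radialExt_smul, Pi.smul_apply]
  rw [fderiv_const_smul (hf.differentiableAt hr x)]
  rfl

/-! The projection onto tangent spaces -/

lemma inner_tanProj {p : E} (hp : p ≠ 0) (v : E) : ⟪p, tanProj p v⟫ = 0 := by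
  have : ⟪p, p⟫ ≠ 0 := inner_self_ne_zero.2 hp
  rw [tanProj, inner_sub_right, inner_smul_right]
  field_simp
  ring

lemma tanProj_of_inner_eq_zero {p v : E} (h : ⟪p, v⟫ = 0) : tanProj p v = v := by
  simp [tanProj, h]

lemma tanProj_add (p v w : E) : tanProj p (v + w) = tanProj p v + tanProj p w := by
  simp only [tanProj, inner_add_right, add_div, add_smul]
  abel

lemma tanProj_smul (p : E) (c : ℝ) (v : E) : tanProj p (c • v) = c • tanProj p v := by
  simp only [tanProj, inner_smul_right, smul_sub, smul_smul, mul_div_assoc]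

lemma tanProj_self {p : E} (hp : p ≠ 0) : tanProj p p = 0 := by
  rw [tanProj, div_self (inner_self_ne_zero.2 hp), one_smul, sub_self]

lemma IsSmooth.tanProj {G : Type*} [NormedAddCommGroup G] [InnerProductSpace ℝ G] (hr : 0 < r)
    {p V : sphere (0 : E) r → G} {s : ℝ} (hp : IsSmooth p) (hps : ∀ x, ⟪p x, p x⟫ = s)
    (hV : IsSmooth V) : IsSmooth (fun x => tanProj (p x) (V x)) := by
  have h := hV.sub ((((hp.inner hr hV).const_smul s⁻¹)).smul hr hp)
  convert h using 1
  funext x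
  simp only [HopfJacobi.tanProj, hps, div_eq_inv_mul, Pi.sub_apply, Pi.smul_apply, smul_eq_mul]

lemma IsSmooth.leviCivita (hr : 0 < r) {X Y : sphere (0 : E) r → E}
    (hX : IsSmooth X) (hY : IsSmooth Y) : IsSmooth (leviCivita X Y) :=
  IsSmooth.tanProj hr (isSmooth_coe hr) inner_self_mem (hX.along hr hY)

lemma hasFDerivAt_proj (hr : 0 < r) (x : sphere (0 : E) r) :
    ∃ L : E →L[ℝ] E, HasFDerivAt (fun y : E => (r / ‖y‖) • y) L x ∧
      ∀ v, L v = HopfJacobi.tanProj (x : E) v := by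
  have hx := ne_zero_of_mem hr x
  have hxr := mem_sphere_zero_iff_norm.1 x.2
  have h0 : HasFDerivAt (fun y : E => ‖y‖ ^ 2) (2 • innerSL ℝ (x : E)) (x : E) :=
    (hasStrictFDerivAt_norm_sq (x : E)).hasFDerivAt
  have hd : DifferentiableAt ℝ (fun y : E => ‖y‖) (x : E) :=
    (contDiffAt_norm ℝ (n := 1) hx).differentiableAt (by simp)
  have h2 := hd.hasFDerivAt.pow 2
  have h3 := h2.unique h0
  have hn : ∀ v, fderiv ℝ (fun y : E => ‖y‖) (x : E) v = ⟪(x : E), v⟫ / r := by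
    intro v
    have := DFunLike.congr_fun h3 v
    simp [hxr] at this
    field_simp
    linarith
  have h4 := ((hasDerivAt_inv (x := ‖(x : E)‖) (by rw [hxr]; exact hr.ne')).comp_hasFDerivAt
    (x : E) hd.hasFDerivAt).const_mul r
  have h5 := h4.smul (hasFDerivAt_id (x : E))
  refine ⟨_, h5, fun v => ?_⟩
  have hi := inner_self_mem x
  simp only [HopfJacobi.tanProj, hi]
  simp [hn, hxr, hr.ne', sub_eq_add_neg, ← neg_smul]
  congr 1
  field_simp

/-- For the restriction to the sphere of a function `g` on the ambient space, `along` is the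
derivative of `g` in the direction of (the tangential part of) `X`. -/
lemma along_restrict (hr : 0 < r) (X : sphere (0 : E) r → E) {f : sphere (0 : E) r → F} {g : E → F}
    (h : ∀ x, f x = g x) (x : sphere (0 : E) r) (hg : DifferentiableAt ℝ g x) :
    along X f x = fderiv ℝ g x (HopfJacobi.tanProj (x : E) (X x)) := by
  obtain ⟨L, hL, hLv⟩ := hasFDerivAt_proj hr x
  have hx := ne_zero_of_mem hr x
  have h1 : radialExt f =ᶠ[nhds (x : E)] fun y => g ((r / ‖y‖) • y) := by
    filter_upwards [isOpen_compl_singleton.mem_nhds hx] with y hy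
    rw [radialExt_apply hr f hy, h]
  have h2 : HasFDerivAt g (fderiv ℝ g x) ((r / ‖(x : E)‖) • (x : E)) := by
    rw [proj_coe hr x]
    exact hg.hasFDerivAt
  have h3 := HasFDerivAt.comp (f := fun y : E => (r / ‖y‖) • y) (x : E) h2 hL
  rw [along, h1.fderiv_eq]
  have h4 : fderiv ℝ (fun y => g ((r / ‖y‖) • y)) (x : E) = _ := HasFDerivAt.fderiv h3
  rw [h4]
  simp [hLv]

/-! The curvature of the sphere -/

lemma hasFDerivAt_ambient (c : ℝ) (w x : E) :
    ∃ L : E →L[ℝ] E, HasFDerivAt (fun y : E => w - (c * ⟪y, w⟫) • y) L x ∧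
      ∀ v, L v = -((c * ⟪x, w⟫) • v + (c * ⟪v, w⟫) • x) := by
  have h1 : HasFDerivAt (fun y : E => ⟪y, w⟫) (innerSL ℝ w) x := by
    have := (innerSL ℝ w).hasFDerivAt (x := x)
    refine this.congr_of_eventuallyEq (Filter.Eventually.of_forall fun y => ?_)
    simp [real_inner_comm]
  have h2 := ((h1.const_mul c).smul (hasFDerivAt_id x)).const_sub w
  refine ⟨_, h2, fun v => ?_⟩
  simp [real_inner_comm]

lemma leviCivita_extend (hr : 0 < r) {X : sphere (0 : E) r → E} (w : E) (x : sphere (0 : E) r) :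
    leviCivita X (extend r w) x
      = -(((r ^ 2)⁻¹ * ⟪(x : E), w⟫) • HopfJacobi.tanProj (x : E) (X x)) := by
  obtain ⟨L, hL, hLv⟩ := hasFDerivAt_ambient ((r ^ 2)⁻¹) w (x : E)
  have hx := ne_zero_of_mem hr x
  have h1 : ∀ z : sphere (0 : E) r,
      extend r w z = w - ((r ^ 2)⁻¹ * ⟪(z : E), w⟫) • (z : E) := by
    intro z
    rw [extend, HopfJacobi.tanProj, inner_self_mem, div_eq_inv_mul]
  rw [leviCivita, along_restrict hr X h1 x hL.differentiableAt, hL.fderiv, hLv, ← neg_one_smul ℝ,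
    tanProj_smul, tanProj_add, tanProj_smul, tanProj_smul, tanProj_self hx,
    tanProj_of_inner_eq_zero (inner_tanProj hx (X x)), neg_one_smul, smul_zero, add_zero]

/-- The sphere of radius `r` has constant curvature `r⁻²`. -/
lemma curvatureAt_eq (hr : 0 < r) (y : sphere (0 : E) r) {u v w : E} (hu : ⟪(y : E), u⟫ = 0)
    (hv : ⟪(y : E), v⟫ = 0) (hw : ⟪(y : E), w⟫ = 0) :
    curvatureAt y u v w = (r ^ 2)⁻¹ • (⟪v, w⟫ • u - ⟪u, w⟫ • v) := by
  have hy := ne_zero_of_mem hr y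
  have key : ∀ a b : E, ⟪(y : E), a⟫ = 0 → ⟪(y : E), b⟫ = 0 →
      leviCivita (extend r a) (leviCivita (extend r b) (extend r w)) y
        = -(((r ^ 2)⁻¹ * ⟪a, w⟫) • b) := by
    intro a b ha hb
    obtain ⟨L, hL, hLv⟩ := hasFDerivAt_ambient ((r ^ 2)⁻¹) b (y : E)
    have h1 : HasFDerivAt (fun z : E => ⟪z, w⟫) (innerSL ℝ w) (y : E) := by
      have := (innerSL ℝ w).hasFDerivAt (x := (y : E))
      refine this.congr_of_eventuallyEq (Filter.Eventually.of_forall fun y => ?_)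
      simp [real_inner_comm]
    have h2 := ((h1.const_mul ((r ^ 2)⁻¹)).smul hL).neg
    have h3 : ∀ z : sphere (0 : E) r, leviCivita (extend r b) (extend r w) z
        = -(((r ^ 2)⁻¹ * ⟪(z : E), w⟫) • (b - ((r ^ 2)⁻¹ * ⟪(z : E), b⟫) • (z : E))) := by
      intro z
      have hz := ne_zero_of_mem hr z
      rw [leviCivita_extend hr, extend, tanProj_of_inner_eq_zero (inner_tanProj hz b),
        HopfJacobi.tanProj, inner_self_mem, div_eq_inv_mul]
    have ha' : HopfJacobi.tanProj (y : E) (extend r a y) = a := by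
      rw [extend, tanProj_of_inner_eq_zero (inner_tanProj hy a), tanProj_of_inner_eq_zero ha]
    have h4 := along_restrict hr (extend r a) h3 y h2.differentiableAt
    rw [h2.fderiv, ha'] at h4
    rw [leviCivita, h4]
    simp only [neg_apply, smul_apply,
      ContinuousLinearMap.smulRight_apply, innerSL_apply_apply,
      hw, hb, mul_zero, zero_smul, sub_zero, zero_add, smul_eq_mul]
    rw [← neg_smul, tanProj_smul, tanProj_of_inner_eq_zero hb, neg_smul, real_inner_comm]
  rw [curvatureAt, curvature, Pi.sub_apply, Pi.sub_apply, key u v hu hv, key v u hv hu,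
    leviCivita_extend hr, hw]
  simp only [mul_zero, zero_smul, neg_zero, sub_zero, smul_sub, smul_smul]
  abel

end Sphere

/-! ### The Hopf map -/

/-- The sphere `S³(√2)`. A point `(x¹, x², x³, x⁴)` has the coordinates `x 0`, `x 1`, `x 2`, `x 3`
and stands for `(z, w) = (x¹ + i x², x³ + i x⁴)`. -/
abbrev S3 : Type := sphere (0 : EuclideanSpace ℝ (Fin 4)) (√2)

/-- The sphere `S²(1/√2)`. -/
abbrev S2 : Type := sphere (0 : EuclideanSpace ℝ (Fin 3)) (1 / √2)

lemma sqrt_two_pos : 0 < √(2 : ℝ) := by positivity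

lemma one_div_sqrt_two_pos : 0 < 1 / √(2 : ℝ) := by positivity

lemma sq_sqrt_two : √(2 : ℝ) ^ 2 = 2 := Real.sq_sqrt (by norm_num)

lemma sum_sq (x : S3) : (x.1 0) ^ 2 + (x.1 1) ^ 2 + (x.1 2) ^ 2 + (x.1 3) ^ 2 = 2 := by
  have h := inner_self_mem x
  rw [sq_sqrt_two, PiLp.inner_apply, Fin.sum_univ_four] at h
  simp only [RCLike.inner_apply, conj_trivial] at h
  linarith

/-- The formula `(1 / (2√2)) (2 z w̄, |z|² - |w|²)` of the Hopf map, on all of `ℝ⁴`. -/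
def hopfFormula (x : EuclideanSpace ℝ (Fin 4)) : EuclideanSpace ℝ (Fin 3) :=
  (1 / (2 * √2)) • !₂[2 * x 0 * x 2 + 2 * x 1 * x 3, 2 * x 1 * x 2 - 2 * x 0 * x 3,
    (x 0) ^ 2 + (x 1) ^ 2 - (x 2) ^ 2 - (x 3) ^ 2]

lemma hopfFormula_mem (x : S3) :
    hopfFormula x ∈ sphere (0 : EuclideanSpace ℝ (Fin 3)) (1 / √2) := by
  have h := sum_sq x
  have h2 := sq_sqrt_two
  rw [mem_sphere_zero_iff_norm, ← sq_eq_sq₀ (norm_nonneg _) (by positivity),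
    EuclideanSpace.norm_sq_eq]
  simp only [hopfFormula, Fin.sum_univ_three, PiLp.smul_apply, Real.norm_eq_abs, sq_abs,
    smul_eq_mul]
  simp
  field_simp
  simp only [h2]
  have : ((x.1 0) ^ 2 + (x.1 1) ^ 2 + (x.1 2) ^ 2 + (x.1 3) ^ 2) ^ 2 = 4 := by rw [h]; norm_num
  linear_combination this

/-- The Hopf map `ψ : S³(√2) → S²(1/√2)`. -/
def hopf (x : S3) : S2 := ⟨hopfFormula x, hopfFormula_mem x⟩

/-- Multiplication by `i` on `ℂ² = ℝ⁴`. -/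
def mulI (x : EuclideanSpace ℝ (Fin 4)) : EuclideanSpace ℝ (Fin 4) :=
  !₂[-x 1, x 0, -x 3, x 2]

/-- The vector fields `X₁`, `X₂`, `X₃` (here `frame 0`, `frame 1`, `frame 2`) on `S³(√2)`. -/
def frame : Fin 3 → S3 → EuclideanSpace ℝ (Fin 4) :=
  ![fun x => (1 / √2) • mulI x,
    fun x => (1 / √2) • !₂[-x.1 2, x.1 3, x.1 0, -x.1 1],
    fun x => (1 / √2) • !₂[-x.1 3, -x.1 2, x.1 1, x.1 0]]

lemma frame_tangent (i : Fin 3) (x : S3) : ⟪(x : EuclideanSpace ℝ (Fin 4)), frame i x⟫ = 0 := by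
  fin_cases i <;> simp [frame, mulI, PiLp.inner_apply, Fin.sum_univ_four] <;> ring

/-- `X₁, X₂, X₃` is a global orthonormal frame of tangent vector fields. -/
lemma frame_orthonormal (x : S3) : Orthonormal ℝ (fun i => frame i x) := by
  have h := sum_sq x
  have h2 := sq_sqrt_two
  rw [orthonormal_iff_ite]
  intro i j
  simp only [PiLp.inner_apply, Fin.sum_univ_four, RCLike.inner_apply, conj_trivial]
  fin_cases i <;> fin_cases j <;> simp [frame, mulI] <;> field_simp <;> linarith

/-- The differential of the Hopf map applied to a tangent vector field: the section `dψ(X)` of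
`ψ⁻¹ T S²(1/√2)`, viewed as a map into `ℝ³`. -/
def dHopf (X : S3 → EuclideanSpace ℝ (Fin 4)) : S3 → EuclideanSpace ℝ (Fin 3) :=
  along X (fun x => (hopf x : EuclideanSpace ℝ (Fin 3)))

/-- The connection `∇^ψ_X V` of the pull-back bundle `ψ⁻¹ T S²(1/√2)`, induced by the Levi-Civita
connection of the sphere `S²(1/√2)` in `ℝ³`: the part of the derivative of `V` along `X` that is
tangent to `S²(1/√2)` at `ψ(x)`. -/
def pullConn (X : S3 → EuclideanSpace ℝ (Fin 4)) (V : S3 → EuclideanSpace ℝ (Fin 3)) (x : S3) :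
    EuclideanSpace ℝ (Fin 3) :=
  tanProj (hopf x : EuclideanSpace ℝ (Fin 3)) (along X V x)

/-- The Laplacian `Δ f = - trace ∇ d f` of functions on `S³(√2)`. -/
def laplaceFun (f : S3 → ℝ) : S3 → ℝ :=
  -∑ i, (along (frame i) (along (frame i) f) - along (leviCivita (frame i) (frame i)) f)

/-- The Laplacian `Δ^ψ V = - trace (∇^ψ)² V` of sections of `ψ⁻¹ T S²(1/√2)`. -/
def roughLaplaceFun (V : S3 → EuclideanSpace ℝ (Fin 3)) : S3 → EuclideanSpace ℝ (Fin 3) :=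
  -∑ i, (pullConn (frame i) (pullConn (frame i) V) - pullConn (leviCivita (frame i) (frame i)) V)

/-- The curvature term `trace R(dψ, V) dψ`, where `R` is the curvature of `S²(1/√2)`. -/
def curvatureTerm (V : S3 → EuclideanSpace ℝ (Fin 3)) (x : S3) : EuclideanSpace ℝ (Fin 3) :=
  ∑ i, curvatureAt (hopf x) (dHopf (frame i) x) (V x) (dHopf (frame i) x)

/-- The Jacobi operator `J^ψ V = Δ^ψ V + trace R(dψ, V) dψ`. -/
def jacobiFun (V : S3 → EuclideanSpace ℝ (Fin 3)) : S3 → EuclideanSpace ℝ (Fin 3) :=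
  roughLaplaceFun V + curvatureTerm V

lemma fibreCurve_mem (x : S3) (s : ℝ) :
    Real.cos (s / √2) • (x : EuclideanSpace ℝ (Fin 4)) + Real.sin (s / √2) • mulI x
      ∈ sphere (0 : EuclideanSpace ℝ (Fin 4)) (√2) := by
  rw [mem_sphere_zero_iff_norm, ← sq_eq_sq₀ (norm_nonneg _) (by positivity),
    EuclideanSpace.norm_sq_eq, sq_sqrt_two]
  simp only [Fin.sum_univ_four, PiLp.smul_apply, PiLp.add_apply, Real.norm_eq_abs, sq_abs,
    smul_eq_mul]
  simp [mulI]
  linear_combination sum_sq x + ((x.1 0) ^ 2 + (x.1 1) ^ 2 + (x.1 2) ^ 2 + (x.1 3) ^ 2) *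
    Real.sin_sq_add_cos_sq (s / √2)

/-- The arc length parametrization `s ↦ e^{i s / √2} (z, w)` of the fibre of the Hopf map through
the point `x = (z, w)`, a great circle. -/
def fibreCurve (x : S3) (s : ℝ) : S3 :=
  ⟨Real.cos (s / √2) • (x : EuclideanSpace ℝ (Fin 4)) + Real.sin (s / √2) • mulI x,
    fibreCurve_mem x s⟩

/-- The vertical Laplacian: `(Δ^V f)(x)` is the value at `x` of the Laplacian on the fibre of `ψ`
through `x` of the restriction of `f`, that is, minus its second derivative with respect to the
arc length. -/
def vertLaplaceFun (f : S3 → ℝ) (x : S3) : ℝ :=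
  -deriv (deriv fun s => f (fibreCurve x s)) 0

/-! Smoothness -/

lemma contDiff_mulI : ContDiff ℝ ∞ mulI := by
  unfold mulI
  rw [contDiff_euclidean]
  intro i
  fin_cases i <;> simp <;> fun_prop

lemma contDiff_hopfFormula : ContDiff ℝ ∞ hopfFormula := by
  unfold hopfFormula
  refine ContDiff.const_smul _ ?_
  rw [contDiff_euclidean]
  intro i
  fin_cases i <;> simp <;> fun_prop

lemma isSmooth_frame (i : Fin 3) : IsSmooth (frame i) := by
  have h : ∃ g : EuclideanSpace ℝ (Fin 4) → EuclideanSpace ℝ (Fin 4), ContDiff ℝ ∞ g ∧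
      ∀ x : S3, frame i x = g x := by
    fin_cases i
    · exact ⟨fun x => (1 / √2) • mulI x, contDiff_mulI.const_smul _, fun _ => rfl⟩
    · refine ⟨fun x => (1 / √2) • !₂[-x 2, x 3, x 0, -x 1], ContDiff.const_smul _ ?_,
        fun _ => rfl⟩
      rw [contDiff_euclidean]
      intro i
      fin_cases i <;> simp <;> fun_prop
    · refine ⟨fun x => (1 / √2) • !₂[-x 3, -x 2, x 1, x 0], ContDiff.const_smul _ ?_,
        fun _ => rfl⟩
      rw [contDiff_euclidean]
      intro i
      fin_cases i <;> simp <;> fun_prop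
  obtain ⟨g, hg, h⟩ := h
  exact isSmooth_of_contDiffOn sqrt_two_pos hg.contDiffOn h

lemma isSmooth_hopf : IsSmooth (fun x : S3 => (hopf x : EuclideanSpace ℝ (Fin 3))) :=
  isSmooth_of_contDiffOn sqrt_two_pos contDiff_hopfFormula.contDiffOn fun _ => rfl

/-! Facts that show the above definitions to be what they should be -/

lemma hasDerivAt_fibreCurve (x : S3) (s : ℝ) :
    HasDerivAt (fun s => (fibreCurve x s : EuclideanSpace ℝ (Fin 4)))
      (frame 0 (fibreCurve x s)) s := by
  have h1 : HasDerivAt (fun s : ℝ => s / √2) (1 / √2) s := (hasDerivAt_id s).div_const _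
  have h2 := (h1.cos.smul_const (x : EuclideanSpace ℝ (Fin 4))).add
    (h1.sin.smul_const (mulI x))
  refine h2.congr_deriv ?_
  ext i
  fin_cases i <;> simp [frame, mulI, fibreCurve] <;> ring

lemma fibreCurve_zero (x : S3) : fibreCurve x 0 = x := by
  apply Subtype.ext
  simp [fibreCurve]

/-- `fibreCurve x` parametrizes the whole fibre of the Hopf map through `x`. -/
lemma range_fibreCurve (x : S3) : Set.range (fibreCurve x) = hopf ⁻¹' {hopf x} := by
  have hx := sum_sq x
  have hs := sqrt_two_pos.ne'
  ext y
  have hy := sum_sq y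
  simp only [Set.mem_range, Set.mem_preimage, Set.mem_singleton_iff]
  constructor
  · rintro ⟨s, rfl⟩
    apply Subtype.ext
    have h := Real.sin_sq_add_cos_sq (s / √2)
    simp only [hopf, hopfFormula]
    congr 1
    ext i
    fin_cases i <;> simp [fibreCurve, mulI]
    · linear_combination (2 * x.1 0 * x.1 2 + 2 * x.1 1 * x.1 3) * h
    · linear_combination (2 * x.1 1 * x.1 2 - 2 * x.1 0 * x.1 3) * h
    · linear_combination (x.1 0 ^ 2 + x.1 1 ^ 2 - x.1 2 ^ 2 - x.1 3 ^ 2) * h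
  · intro h
    have h' : hopfFormula y = hopfFormula x := congrArg Subtype.val h
    have h0 := congrArg (fun v => v 0) h'
    have h1 := congrArg (fun v => v 1) h'
    have h2 := congrArg (fun v => v 2) h'
    simp [hopfFormula] at h0 h1 h2
    set a := (x.1 0 * y.1 0 + x.1 1 * y.1 1 + x.1 2 * y.1 2 + x.1 3 * y.1 3) / 2 with ha
    set b := (x.1 0 * y.1 1 - x.1 1 * y.1 0 + x.1 2 * y.1 3 - x.1 3 * y.1 2) / 2 with hb
    have f0 : y.1 0 * y.1 2 + y.1 1 * y.1 3 = x.1 0 * x.1 2 + x.1 1 * x.1 3 := by linarith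
    have f1 : y.1 1 * y.1 2 - y.1 0 * y.1 3 = x.1 1 * x.1 2 - x.1 0 * x.1 3 := by linarith
    have f2 : y.1 0 ^ 2 + y.1 1 ^ 2 = x.1 0 ^ 2 + x.1 1 ^ 2 := by linarith
    have f3 : y.1 2 ^ 2 + y.1 3 ^ 2 = x.1 2 ^ 2 + x.1 3 ^ 2 := by linarith
    have e0 : a * x.1 0 - b * x.1 1 = y.1 0 := by
      rw [ha, hb]
      linear_combination (-y.1 2 / 2) * f0 + (y.1 3 / 2) * f1 + (y.1 0 / 2) * f3 + (y.1 0 / 2) * hx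
    have e1 : a * x.1 1 + b * x.1 0 = y.1 1 := by
      rw [ha, hb]
      linear_combination (-y.1 3 / 2) * f0 + (-y.1 2 / 2) * f1 + (y.1 1 / 2) * f3 + (y.1 1 / 2) * hx
    have e2 : a * x.1 2 - b * x.1 3 = y.1 2 := by
      rw [ha, hb]
      linear_combination (-y.1 0 / 2) * f0 + (-y.1 1 / 2) * f1 + (y.1 2 / 2) * f2 + (y.1 2 / 2) * hx
    have e3 : a * x.1 3 + b * x.1 2 = y.1 3 := by
      rw [ha, hb]
      linear_combination (-y.1 1 / 2) * f0 + (y.1 0 / 2) * f1 + (y.1 3 / 2) * f2 + (y.1 3 / 2) * hx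
    have hab : a ^ 2 + b ^ 2 = 1 := by
      rw [← e0, ← e1, ← e2, ← e3] at hy
      linear_combination (1 / 2) * hy - (a ^ 2 + b ^ 2) / 2 * hx
    obtain ⟨t, ht⟩ : ∃ t : ℝ, Real.cos t = a ∧ Real.sin t = b := by
      have hn : ‖(⟨a, b⟩ : ℂ)‖ = 1 := by
        rw [Complex.norm_def, Complex.normSq_mk, Real.sqrt_eq_one]
        linarith
      have hc : (⟨a, b⟩ : ℂ) ≠ 0 := by
        rw [← norm_ne_zero_iff, hn]
        exact one_ne_zero
      exact ⟨Complex.arg ⟨a, b⟩, by rw [Complex.cos_arg hc, hn, div_one],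
        by rw [Complex.sin_arg, hn, div_one]⟩
    refine ⟨√2 * t, Subtype.ext ?_⟩
    have h3 : √2 * t / √2 = t := by field_simp
    ext i
    fin_cases i <;> simp [fibreCurve, mulI, h3, ht] <;> linarith

lemma vertLaplaceFun_eq {f : S3 → ℝ} (hf : IsSmooth f) :
    vertLaplaceFun f = -along (frame 0) (along (frame 0) f) := by
  have key : ∀ {g : S3 → ℝ}, IsSmooth g → ∀ x s,
      HasDerivAt (fun s => g (fibreCurve x s)) (along (frame 0) g (fibreCurve x s)) s := by
    intro g hg x s
    have h := (hg.differentiableAt sqrt_two_pos (fibreCurve x s)).hasFDerivAt.comp_hasDerivAt s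
      (hasDerivAt_fibreCurve x s)
    refine h.congr_of_eventuallyEq (Filter.Eventually.of_forall fun t => ?_)
    exact (radialExt_coe sqrt_two_pos g (fibreCurve x t)).symm
  funext x
  have h1 : (deriv fun s => f (fibreCurve x s)) =
      fun s => along (frame 0) f (fibreCurve x s) := funext fun s => (key hf x s).deriv
  rw [vertLaplaceFun, h1, (key ((isSmooth_frame 0).along sqrt_two_pos hf) x 0).deriv,
    fibreCurve_zero]
  rfl

/-! ### Spaces of functions and sections, and the operators on them -/

/-- `C^∞(S³(√2))`. -/
def SmoothFun : Submodule ℝ (S3 → ℝ) where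
  carrier := {f | IsSmooth f}
  add_mem' := IsSmooth.add
  zero_mem' := isSmooth_zero
  smul_mem' c _ hf := IsSmooth.const_smul c hf

/-- `C(ψ⁻¹ T S²(1/√2))`: the smooth sections of the pull-back of the tangent bundle, that is, the
smooth maps `V` into `ℝ³` with `V(x)` tangent to `S²(1/√2)` at `ψ(x)` for all `x`. -/
def Sections : Submodule ℝ (S3 → EuclideanSpace ℝ (Fin 3)) where
  carrier := {V | IsSmooth V ∧ ∀ x, ⟪(hopf x : EuclideanSpace ℝ (Fin 3)), V x⟫ = 0}
  add_mem' hV hW := ⟨hV.1.add hW.1, fun x => by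
    rw [Pi.add_apply, inner_add_right, hV.2, hW.2, add_zero]⟩
  zero_mem' := ⟨isSmooth_zero, fun x => by simp⟩
  smul_mem' c _ hV := ⟨hV.1.const_smul c, fun x => by
    rw [Pi.smul_apply, inner_smul_right, hV.2, mul_zero]⟩

lemma hopf_ne_zero (x : S3) : (hopf x : EuclideanSpace ℝ (Fin 3)) ≠ 0 :=
  ne_zero_of_mem one_div_sqrt_two_pos (hopf x)

lemma smooth_pullConn {X : S3 → EuclideanSpace ℝ (Fin 4)} (hX : IsSmooth X)
    {V : S3 → EuclideanSpace ℝ (Fin 3)} (hV : IsSmooth V) : IsSmooth (pullConn X V) :=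
  IsSmooth.tanProj sqrt_two_pos isSmooth_hopf (fun x => inner_self_mem (hopf x))
    (hX.along sqrt_two_pos hV)

lemma pullConn_add (X : S3 → EuclideanSpace ℝ (Fin 4)) {V W : S3 → EuclideanSpace ℝ (Fin 3)}
    (hV : IsSmooth V) (hW : IsSmooth W) : pullConn X (V + W) = pullConn X V + pullConn X W := by
  funext x
  simp only [pullConn, along_add sqrt_two_pos X hV hW, Pi.add_apply, tanProj_add]

lemma pullConn_smul (X : S3 → EuclideanSpace ℝ (Fin 4)) (c : ℝ)
    {V : S3 → EuclideanSpace ℝ (Fin 3)} (hV : IsSmooth V) :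
    pullConn X (c • V) = c • pullConn X V := by
  funext x
  simp only [pullConn, along_smul sqrt_two_pos X c hV, Pi.smul_apply, tanProj_smul]

lemma smooth_leviCivita_frame (i : Fin 3) : IsSmooth (leviCivita (frame i) (frame i)) :=
  (isSmooth_frame i).leviCivita sqrt_two_pos (isSmooth_frame i)

/-- The derivation `f ↦ X_{i+1} f` of `C^∞(S³(√2))`. -/
def deriveFrame (i : Fin 3) : SmoothFun →ₗ[ℝ] SmoothFun where
  toFun f := ⟨along (frame i) f, (isSmooth_frame i).along sqrt_two_pos f.2⟩
  map_add' f g := Subtype.ext (along_add sqrt_two_pos _ f.2 g.2)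
  map_smul' c f := Subtype.ext (along_smul sqrt_two_pos _ c f.2)

lemma smooth_laplaceFun {f : S3 → ℝ} (hf : IsSmooth f) : IsSmooth (laplaceFun f) :=
  (IsSmooth.sum _ fun i =>
    ((isSmooth_frame i).along sqrt_two_pos ((isSmooth_frame i).along sqrt_two_pos hf)).sub
      ((smooth_leviCivita_frame i).along sqrt_two_pos hf)).neg

/-- The Laplacian `Δ` as a linear operator on `C^∞(S³(√2))`. -/
def laplace : SmoothFun →ₗ[ℝ] SmoothFun where
  toFun f := ⟨laplaceFun f, smooth_laplaceFun f.2⟩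
  map_add' f g := by
    refine Subtype.ext ?_
    have h := fun i => (isSmooth_frame i).along sqrt_two_pos f.2
    have h' := fun i => (isSmooth_frame i).along sqrt_two_pos g.2
    simp only [laplaceFun, Submodule.coe_add, along_add sqrt_two_pos _ f.2 g.2,
      along_add sqrt_two_pos _ (h _) (h' _), Finset.sum_sub_distrib, Finset.sum_add_distrib]
    abel
  map_smul' c f := by
    refine Subtype.ext ?_
    have h := fun i => (isSmooth_frame i).along sqrt_two_pos f.2
    simp only [laplaceFun, Submodule.coe_smul, along_smul sqrt_two_pos _ c f.2, RingHom.id_apply,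
      along_smul sqrt_two_pos _ c (h _), ← smul_sub, ← Finset.smul_sum, smul_neg]

/-- The vertical Laplacian `Δ^V` as a linear operator on `C^∞(S³(√2))`. -/
def vertLaplace : SmoothFun →ₗ[ℝ] SmoothFun where
  toFun f := ⟨vertLaplaceFun f, by
    rw [vertLaplaceFun_eq f.2]
    exact (deriveFrame 0 (deriveFrame 0 f)).2.neg⟩
  map_add' f g := by
    refine Subtype.ext ?_
    have h : (vertLaplaceFun (f + g : SmoothFun) : S3 → ℝ)
      = vertLaplaceFun f + vertLaplaceFun g := by
      rw [vertLaplaceFun_eq f.2, vertLaplaceFun_eq g.2, vertLaplaceFun_eq (f + g).2]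
      change -(deriveFrame 0 (deriveFrame 0 (f + g)) : S3 → ℝ) = _
      rw [map_add, map_add, Submodule.coe_add, neg_add]
      rfl
    exact h
  map_smul' c f := by
    refine Subtype.ext ?_
    have h : (vertLaplaceFun (c • f : SmoothFun) : S3 → ℝ) = c • vertLaplaceFun f := by
      rw [vertLaplaceFun_eq f.2, vertLaplaceFun_eq (c • f).2]
      change -(deriveFrame 0 (deriveFrame 0 (c • f)) : S3 → ℝ) = _
      rw [map_smul, map_smul, Submodule.coe_smul, ← smul_neg]
      rfl
    exact h

lemma inner_dHopf (X : S3 → EuclideanSpace ℝ (Fin 4)) (x : S3) :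
    ⟪(hopf x : EuclideanSpace ℝ (Fin 3)), dHopf X x⟫ = 0 := by
  have hd := (isSmooth_hopf.differentiableAt sqrt_two_pos x).hasFDerivAt
  have h1 := hd.inner ℝ hd
  have h2 : (fun y => ⟪radialExt (fun x : S3 => (hopf x : EuclideanSpace ℝ (Fin 3))) y,
      radialExt (fun x : S3 => (hopf x : EuclideanSpace ℝ (Fin 3))) y⟫)
      =ᶠ[nhds (x : EuclideanSpace ℝ (Fin 4))] fun _ => (1 / √2) ^ 2 := by
    filter_upwards [isOpen_compl_singleton.mem_nhds (ne_zero_of_mem sqrt_two_pos x)] with y hy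
    rw [radialExt_apply sqrt_two_pos _ hy, inner_self_mem]
  have h3 := h1.unique ((hasFDerivAt_const _ _).congr_of_eventuallyEq h2)
  have h4 := DFunLike.congr_fun h3 (X x)
  simp [radialExt_coe sqrt_two_pos] at h4
  have h5 : ⟪(hopf x : EuclideanSpace ℝ (Fin 3)), fderiv ℝ
    (radialExt (fun x : S3 => (hopf x : EuclideanSpace ℝ (Fin 3)))) x (X x)⟫ = 0 := by
    rw [real_inner_comm] at h4 ⊢
    linarith
  exact h5

lemma smooth_dHopf {X : S3 → EuclideanSpace ℝ (Fin 4)} (hX : IsSmooth X) : IsSmooth (dHopf X) :=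
  hX.along sqrt_two_pos isSmooth_hopf

/-- The section `dψ(X_{i+1})` of `ψ⁻¹ T S²(1/√2)`. -/
def dHopfFrame (i : Fin 3) : Sections :=
  ⟨dHopf (frame i), smooth_dHopf (isSmooth_frame i), inner_dHopf _⟩

/-- Multiplication `f ↦ f V` of functions on `S³(√2)` with a section `V`. -/
def mulSection (V : Sections) : SmoothFun →ₗ[ℝ] Sections where
  toFun f := ⟨fun x => f.1 x • V.1 x, IsSmooth.smul sqrt_two_pos f.2 V.2.1, fun x => by
    rw [inner_smul_right, V.2.2, mul_zero]⟩
  map_add' f g := by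
    refine Subtype.ext (funext fun x => ?_)
    exact add_smul (f.1 x) (g.1 x) (V.1 x)
  map_smul' c f := by
    refine Subtype.ext (funext fun x => ?_)
    exact mul_smul c (f.1 x) (V.1 x)

lemma curvatureTerm_eq (V : Sections) (x : S3) :
    curvatureTerm V x = ((1 / √2) ^ 2)⁻¹ • ∑ i, (⟪V.1 x, dHopf (frame i) x⟫ • dHopf (frame i) x
      - ⟪dHopf (frame i) x, dHopf (frame i) x⟫ • V.1 x) := by
  rw [curvatureTerm, Finset.smul_sum]
  exact Finset.sum_congr rfl fun i _ => curvatureAt_eq one_div_sqrt_two_pos _ (inner_dHopf _ x)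
    (V.2.2 x) (inner_dHopf _ x)

lemma curvatureTerm_mem (V : Sections) : curvatureTerm V ∈ Sections := by
  have h : curvatureTerm V = ((1 / √2) ^ 2)⁻¹ • ∑ i, ((fun x => ⟪V.1 x, dHopf (frame i) x⟫ •
      dHopf (frame i) x) - fun x => ⟪dHopf (frame i) x, dHopf (frame i) x⟫ • V.1 x) := by
    funext x
    rw [curvatureTerm_eq]
    simp only [Pi.smul_apply, Finset.sum_apply, Pi.sub_apply]
  rw [h]
  refine Sections.smul_mem _ (Sections.sum_mem fun i _ => Sections.sub_mem ?_ ?_)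
  · exact (mulSection (dHopfFrame i) ⟨_, V.2.1.inner sqrt_two_pos (dHopfFrame i).2.1⟩).2
  · exact (mulSection V ⟨_, (dHopfFrame i).2.1.inner sqrt_two_pos (dHopfFrame i).2.1⟩).2

lemma pullConn_mem {X : S3 → EuclideanSpace ℝ (Fin 4)} (hX : IsSmooth X)
    {V : S3 → EuclideanSpace ℝ (Fin 3)} (hV : IsSmooth V) : pullConn X V ∈ Sections :=
  ⟨smooth_pullConn hX hV, fun x => inner_tanProj (hopf_ne_zero x) _⟩

/-- The Jacobi operator `J^ψ` as a linear operator on `C(ψ⁻¹ T S²(1/√2))`. -/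
def jacobi : Sections →ₗ[ℝ] Sections where
  toFun V := ⟨jacobiFun V, Sections.add_mem (Sections.neg_mem (Sections.sum_mem fun i _ =>
    Sections.sub_mem (pullConn_mem (isSmooth_frame i) (smooth_pullConn (isSmooth_frame i) V.2.1))
      (pullConn_mem (smooth_leviCivita_frame i) V.2.1))) (curvatureTerm_mem V)⟩
  map_add' V W := by
    refine Subtype.ext ?_
    have h := fun i => smooth_pullConn (isSmooth_frame i) V.2.1
    have h' := fun i => smooth_pullConn (isSmooth_frame i) W.2.1
    have h1 : roughLaplaceFun (V + W : Sections) = roughLaplaceFun V + roughLaplaceFun W := by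
      simp only [roughLaplaceFun, Submodule.coe_add, pullConn_add _ V.2.1 W.2.1,
        pullConn_add _ (h _) (h' _), Finset.sum_sub_distrib, Finset.sum_add_distrib]
      abel
    have h2 : curvatureTerm (V + W : Sections) = curvatureTerm V + curvatureTerm W := by
      funext x
      rw [Pi.add_apply, curvatureTerm_eq, curvatureTerm_eq, curvatureTerm_eq, ← smul_add,
        ← Finset.sum_add_distrib]
      congr 1
      refine Finset.sum_congr rfl fun i _ => ?_
      rw [Submodule.coe_add, Pi.add_apply, inner_add_left, add_smul, smul_add]
      abel
    change jacobiFun (V + W : Sections) = jacobiFun V + jacobiFun W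
    simp only [jacobiFun, h1, h2]
    abel
  map_smul' c V := by
    refine Subtype.ext ?_
    have h := fun i => smooth_pullConn (isSmooth_frame i) V.2.1
    have h1 : roughLaplaceFun (c • V : Sections) = c • roughLaplaceFun V := by
      simp only [roughLaplaceFun, Submodule.coe_smul, pullConn_smul _ c V.2.1,
        pullConn_smul _ c (h _), ← smul_sub, ← Finset.smul_sum, smul_neg]
    have h2 : curvatureTerm (c • V : Sections) = c • curvatureTerm V := by
      funext x
      rw [Pi.smul_apply, curvatureTerm_eq, curvatureTerm_eq, smul_comm c, Finset.smul_sum (r := c)]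
      congr 1
      refine Finset.sum_congr rfl fun i _ => ?_
      rw [Submodule.coe_smul, Pi.smul_apply, real_inner_smul_left, mul_smul, smul_sub,
        smul_comm c (⟪dHopf (frame i) x, dHopf (frame i) x⟫)]
    change jacobiFun (c • V : Sections) = c • jacobiFun V
    simp only [jacobiFun, h1, h2, smul_add]

/-- The eigenvalues `λ_k = k (k + 2) / 2` of the Laplacian of `S³(√2)`. -/
def lam (k : ℕ) : ℝ := (k : ℝ) * (k + 2) / 2

/-- The eigenspace `{f ∈ C^∞(S³(√2)) | Δ f = λ_k f}`. -/
def lapEigenspace (k : ℕ) : Submodule ℝ SmoothFun := Module.End.eigenspace laplace (lam k)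

/-- `S^ψ_{λ_k} = {f₂ dψ(X₂) | Δ f₂ = λ_k f₂} ⊕ {f₃ dψ(X₃) | Δ f₃ = λ_k f₃}`. -/
def sectionSpace (k : ℕ) : Submodule ℝ Sections :=
  (lapEigenspace k).map (mulSection (dHopfFrame 1)) ⊔
    (lapEigenspace k).map (mulSection (dHopfFrame 2))

end HopfJacobi

end

noncomputable section

namespace HopfJacobi

/-! ### Derivatives along the frame -/

section Calculus

variable {F : Type*} [NormedAddCommGroup F] [NormedSpace ℝ F]

/-! Write `X₁, X₂, X₃` for `frame 0, frame 1, frame 2`, and a section as `f dψ(X₂) + g dψ(X₃)`.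
Since `X₁ψ = 0`, the relations `[X₁, X₂] = -√2 X₃` and `[X₃, X₁] = -√2 X₂` make the pair `dψ(X₂),
dψ(X₃)` rotate at constant speed along the fibres, while its covariant derivatives along `X₂` and
`X₃` vanish. The rotation contributes `2V` to the rough Laplacian, which the curvature term `-2V`
cancels. What remains is `J(f, g) = (Δf - 2√2 X₁g, Δg + 2√2 X₁f)` (`jacobi_frameSection`).

As `X₁` commutes with `Δ` (`laplace_deriveFrame_zero`), on pairs of `λ_k`-eigenfunctions `J - λ_k`
is `2√2` times `(f, g) ↦ (-X₁g, X₁f)`. So the eigenvalue `λ_k + 2√2 s` means `X₁f = s g` and `X₁g =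
-s f` (`jacobi_frameSection_eq_smul_iff`). Both components then satisfy `Δ^V u = -X₁²u = s² u`, so
`c = s²` and `2√2 |s| = 2√(2c)`. This settles eigenvalues and eigensections; `c ≥ 0` comes from a
maximum principle (`eq_zero_of_sum_along_frame_sq`).

For the multiplicity, the two equations say that `h = f + ig` satisfies `Δh = λ_k h` and `X₁h =
(im/√2) h` with `m = -√2 s`, so the eigenspace is a complex weight space viewed as a real one. The
ladder operators `X₂ ± iX₃` shift `m` by `±2`, and their composites act on a weight space by
scalars. The maximum principle bounds `m`, so raising must stop, and the scalar allows this only at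
`m = k`. Hence every nonzero weight space has the dimension of the one of weight `k`
(`finrank_weightSpace_of_ne_bot`).

A function of weight `k` is killed by raising. Together with its weight this says that its extension
to `ℂ² \ {0}`, homogeneous of degree `k`, is holomorphic. On the line `t ↦ (1, t)` it is entire of
growth `k`, hence a polynomial of degree at most `k`, and this restriction determines it. So these
functions are exactly the binary forms `∑ aⱼ z^(k-j) w^j`, of complex dimension `k + 1`
(`finrank_weightSpace_self`), and the real multiplicity is `2(k + 1)`. -/

/-- The vector fields of the frame as linear maps of `ℝ⁴`. -/
def frameCLM (i : Fin 3) : EuclideanSpace ℝ (Fin 4) →L[ℝ] EuclideanSpace ℝ (Fin 4) :=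
  LinearMap.toContinuousLinearMap
    { toFun := (![fun x => (1 / √2) • mulI x,
        fun x => (1 / √2) • !₂[-x 2, x 3, x 0, -x 1],
        fun x => (1 / √2) • !₂[-x 3, -x 2, x 1, x 0]] :
          Fin 3 → EuclideanSpace ℝ (Fin 4) → EuclideanSpace ℝ (Fin 4)) i
      map_add' := fun x y => by
        ext j
        fin_cases i <;> fin_cases j <;> simp [mulI] <;> ring
      map_smul' := fun c x => by
        ext j
        fin_cases i <;> fin_cases j <;> simp [mulI] <;> ring }

lemma frame_eq (i : Fin 3) (x : S3) : frame i x = frameCLM i x := by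
  fin_cases i <;> rfl

lemma frameCLM_zero_apply (x : EuclideanSpace ℝ (Fin 4)) :
    frameCLM 0 x = (1 / √2) • !₂[-x 1, x 0, -x 3, x 2] := rfl

lemma frameCLM_one_apply (x : EuclideanSpace ℝ (Fin 4)) :
    frameCLM 1 x = (1 / √2) • !₂[-x 2, x 3, x 0, -x 1] := rfl

lemma frameCLM_two_apply (x : EuclideanSpace ℝ (Fin 4)) :
    frameCLM 2 x = (1 / √2) • !₂[-x 3, -x 2, x 1, x 0] := rfl

lemma inv_sqrt_two_mul_self : (√2)⁻¹ * (√2)⁻¹ = (1 / 2 : ℝ) := by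
  rw [← mul_inv, Real.mul_self_sqrt (by norm_num)]
  norm_num

/-- The maps `√2 • frameCLM i` multiply like the imaginary quaternion units, which also accounts for
`frameCLM_comm`. Indices are cyclic modulo 3. -/
lemma frameCLM_sq (i : Fin 3) (x : EuclideanSpace ℝ (Fin 4)) :
    frameCLM i (frameCLM i x) = -((1 / 2 : ℝ) • x) := by
  have h := inv_sqrt_two_mul_self
  ext j
  fin_cases i <;> fin_cases j <;>
    simp [frameCLM_zero_apply, frameCLM_one_apply, frameCLM_two_apply, ← mul_assoc, h]

lemma frameCLM_comm (i : Fin 3) (x : EuclideanSpace ℝ (Fin 4)) :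
    frameCLM (i + 1) (frameCLM i x) - frameCLM i (frameCLM (i + 1) x)
      = -(√2 • frameCLM (i + 2) x) := by
  have h := inv_sqrt_two_mul_self
  ext j
  fin_cases i <;> fin_cases j <;>
    simp [frameCLM_zero_apply, frameCLM_one_apply, frameCLM_two_apply, ← mul_assoc, h] <;> ring

lemma along_frame_comp {f : S3 → F} {g : EuclideanSpace ℝ (Fin 4) → F} (h : ∀ x, f x = g x)
    (i : Fin 3) (x : S3) (hg : DifferentiableAt ℝ g x) :
    along (frame i) f x = fderiv ℝ g x (frameCLM i x) := by
  rw [along_restrict sqrt_two_pos _ h x hg, tanProj_of_inner_eq_zero (frame_tangent i x), frame_eq]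

lemma radialExt_pos_smul (f : S3 → F) {c : ℝ} (hc : 0 < c) {y : EuclideanSpace ℝ (Fin 4)}
    (hy : y ≠ 0) : radialExt f (c • y) = radialExt f y := by
  rw [radialExt_apply sqrt_two_pos f hy,
    radialExt_apply sqrt_two_pos f (smul_ne_zero hc.ne' hy)]
  congr 2
  rw [norm_smul, Real.norm_of_nonneg hc.le, smul_smul]
  congr 1
  field_simp

/-- Euler's identity in degree 0: the radial extension is constant along rays. -/
lemma fderiv_radialExt_self {f : S3 → F} (hf : IsSmooth f) {y : EuclideanSpace ℝ (Fin 4)}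
    (hy : y ≠ 0) : fderiv ℝ (radialExt f) y y = 0 := by
  have hd := ((hf.contDiffAt hy).differentiableAt (by simp)).hasFDerivAt
  have h1 : HasDerivAt (fun t : ℝ => t • y) y 1 := by
    simpa using (hasDerivAt_id (1 : ℝ)).smul_const y
  have h2 := HasFDerivAt.comp_hasDerivAt (f := fun t : ℝ => t • y) 1
    (by simpa using hd) h1
  have h3 : (fun t : ℝ => radialExt f (t • y)) =ᶠ[nhds 1] fun _ => radialExt f y := by
    filter_upwards [lt_mem_nhds (zero_lt_one' ℝ)] with t ht
    exact radialExt_pos_smul f ht hy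
  exact h2.unique ((hasDerivAt_const _ _).congr_of_eventuallyEq h3)

lemma along_frame_along_frame {f : S3 → F} (hf : IsSmooth f) (i j : Fin 3) (x : S3) :
    along (frame i) (along (frame j) f) x
      = fderiv ℝ (fderiv ℝ (radialExt f)) x (frameCLM i x) (frameCLM j x)
        + fderiv ℝ (radialExt f) x (frameCLM j (frameCLM i x)) := by
  have hx := ne_zero_of_mem sqrt_two_pos x
  have h1 : HasFDerivAt (fderiv ℝ (radialExt f)) (fderiv ℝ (fderiv ℝ (radialExt f)) x)
      (x : EuclideanSpace ℝ (Fin 4)) :=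
    (((hf.contDiffAt hx).fderiv_right (m := ∞) (by simp)).differentiableAt (by simp)).hasFDerivAt
  have h2 := h1.clm_apply (frameCLM j).hasFDerivAt
  rw [along_frame_comp (fun y => by rw [along, frame_eq]) i x h2.differentiableAt, h2.fderiv]
  simp [add_comm]

/-- The commutators of the frame. -/
lemma along_frame_comm {f : S3 → F} (hf : IsSmooth f) (i : Fin 3) :
    along (frame i) (along (frame (i + 1)) f) - along (frame (i + 1)) (along (frame i) f)
      = -(√2 • along (frame (i + 2)) f) := by
  funext x
  -- By symmetry of the second derivative the Hessian terms cancel; only the commutator of the two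
  -- linear maps survives.
  have hs := ((hf.contDiffAt (ne_zero_of_mem sqrt_two_pos x)).isSymmSndFDerivAt
    (by rw [minSmoothness_of_isRCLikeNormedField]
        exact WithTop.coe_le_coe.2 (le_top : (2 : ℕ∞) ≤ ⊤))).eq
    (frameCLM i x) (frameCLM (i + 1) x)
  simp only [Pi.sub_apply, Pi.neg_apply, Pi.smul_apply]
  rw [along_frame_along_frame hf, along_frame_along_frame hf, hs, add_sub_add_left_eq_sub,
    ← map_sub, frameCLM_comm, map_neg, map_smul, along, frame_eq]

/-- The second derivative `-x/2` along the field is radial, so the integral curves are geodesics and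
the correction term drops out of both Laplacians. -/
lemma leviCivita_frame_self (i : Fin 3) : leviCivita (frame i) (frame i) = 0 := by
  funext x
  rw [leviCivita, along_frame_comp (frame_eq i) i x (frameCLM i).differentiableAt,
    (frameCLM i).fderiv, frameCLM_sq, ← smul_neg, tanProj_smul, ← neg_one_smul ℝ, tanProj_smul,
    tanProj_self (ne_zero_of_mem sqrt_two_pos x)]
  simp

lemma along_zero (f : S3 → F) : along 0 f = 0 := by
  funext x
  simp [along]

lemma along_clm_comp {G : Type*} [NormedAddCommGroup G] [NormedSpace ℝ G] (T : F →L[ℝ] G)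
    {f : S3 → F} (hf : IsSmooth f) (X : S3 → EuclideanSpace ℝ (Fin 4)) :
    along X (fun x => T (f x)) = fun x => T (along X f x) := by
  funext x
  have h : radialExt (fun x => T (f x)) =ᶠ[nhds (x : EuclideanSpace ℝ (Fin 4))]
      fun y => T (radialExt f y) := by
    filter_upwards [isOpen_compl_singleton.mem_nhds (ne_zero_of_mem sqrt_two_pos x)] with y hy
    rw [radialExt_apply sqrt_two_pos _ hy, radialExt_apply sqrt_two_pos _ hy]
  have h1 : HasFDerivAt (fun y => T (radialExt f y)) _ (x : EuclideanSpace ℝ (Fin 4)) :=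
    T.hasFDerivAt.comp _ (hf.differentiableAt sqrt_two_pos x).hasFDerivAt
  rw [along, h.fderiv_eq, h1.fderiv]
  rfl

lemma IsSmooth.clm_comp {G : Type*} [NormedAddCommGroup G] [NormedSpace ℝ G] (T : F →L[ℝ] G)
    {f : S3 → F} (hf : IsSmooth f) : IsSmooth (fun x => T (f x)) := by
  have h : ContDiffOn ℝ ∞ (fun y => T (radialExt f y)) {0}ᶜ := T.contDiff.comp_contDiffOn hf
  refine h.congr fun y hy => ?_
  rw [radialExt_apply sqrt_two_pos _ hy, radialExt_apply sqrt_two_pos _ hy]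

lemma along_fun_smul {f : S3 → ℝ} {g : S3 → F} (hf : IsSmooth f) (hg : IsSmooth g)
    (X : S3 → EuclideanSpace ℝ (Fin 4)) :
    along X (fun x => f x • g x) = fun x => along X f x • g x + f x • along X g x := by
  funext x
  have h : radialExt (fun x => f x • g x) =ᶠ[nhds (x : EuclideanSpace ℝ (Fin 4))]
      fun y => radialExt f y • radialExt g y := by
    filter_upwards [isOpen_compl_singleton.mem_nhds (ne_zero_of_mem sqrt_two_pos x)] with y hy
    rw [radialExt_apply sqrt_two_pos _ hy, radialExt_apply sqrt_two_pos _ hy,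
      radialExt_apply sqrt_two_pos _ hy]
  rw [along, h.fderiv_eq, fderiv_fun_smul (hf.differentiableAt sqrt_two_pos x)
    (hg.differentiableAt sqrt_two_pos x)]
  simp [along, radialExt_coe sqrt_two_pos, add_comm]

lemma IsSmooth.continuous {f : S3 → F} (hf : IsSmooth f) : Continuous f := by
  have h : Continuous fun x : S3 => radialExt f x :=
    ContDiffOn.continuousOn hf |>.comp_continuous continuous_subtype_val
      fun x => ne_zero_of_mem sqrt_two_pos x
  simpa only [radialExt_coe sqrt_two_pos] using h

/-- The integral curves of the frame, which are great circles. -/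
def frameFlow (i : Fin 3) (x : S3) (s : ℝ) : S3 :=
  ⟨Real.cos (s / √2) • (x : EuclideanSpace ℝ (Fin 4)) + (√2 * Real.sin (s / √2)) • frame i x, by
    have h1 : ⟪(x : EuclideanSpace ℝ (Fin 4)), x⟫ = 2 := by rw [inner_self_mem, sq_sqrt_two]
    have h2 : ⟪frame i x, frame i x⟫ = 1 := by
      rw [real_inner_self_eq_norm_sq, (frame_orthonormal x).1 i, one_pow]
    have h3 := frame_tangent i x
    have h4 : ⟪frame i x, (x : EuclideanSpace ℝ (Fin 4))⟫ = 0 := by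
      rw [real_inner_comm, h3]
    rw [mem_sphere_zero_iff_norm, ← sq_eq_sq₀ (norm_nonneg _) (by positivity),
      ← real_inner_self_eq_norm_sq]
    simp only [inner_add_left, inner_add_right, real_inner_smul_left, real_inner_smul_right,
      h1, h2, h3, h4]
    linear_combination Real.sin (s / √2) ^ 2 * sq_sqrt_two - sq_sqrt_two
      + 2 * Real.sin_sq_add_cos_sq (s / √2)⟩

lemma frameFlow_zero (i : Fin 3) (x : S3) : frameFlow i x 0 = x := by
  apply Subtype.ext
  simp [frameFlow]

lemma hasDerivAt_comp_frameFlow {f : S3 → F} (hf : IsSmooth f) (i : Fin 3) (x : S3) (s : ℝ) :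
    HasDerivAt (fun s => f (frameFlow i x s)) (along (frame i) f (frameFlow i x s)) s := by
  have h0 : HasDerivAt (fun s => (frameFlow i x s : EuclideanSpace ℝ (Fin 4)))
      (frame i (frameFlow i x s)) s := by
    have h1 : HasDerivAt (fun s : ℝ => s / √2) (1 / √2) s := (hasDerivAt_id s).div_const _
    have h2 := (h1.cos.smul_const (x : EuclideanSpace ℝ (Fin 4))).add
      ((h1.sin.const_mul (√2)).smul_const (frame i x))
    refine h2.congr_deriv ?_
    have h4 : (frameFlow i x s : EuclideanSpace ℝ (Fin 4))
        = Real.cos (s / √2) • (x : EuclideanSpace ℝ (Fin 4))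
          + (√2 * Real.sin (s / √2)) • frameCLM i x := by
      rw [← frame_eq]
      rfl
    rw [frame_eq, frame_eq, h4, map_add, map_smul, map_smul, frameCLM_sq, smul_neg,
      smul_smul, add_comm]
    have h3 : √2 * Real.sin (s / √2) * (1 / 2) = Real.sin (s / √2) * (1 / √2) := by
      field_simp
      rw [sq_sqrt_two, mul_comm]
    rw [h3, ← neg_smul, neg_mul]
    congr 2
    field_simp
  have h := (hf.differentiableAt sqrt_two_pos (frameFlow i x s)).hasFDerivAt.comp_hasDerivAt s h0
  refine h.congr_of_eventuallyEq (Filter.Eventually.of_forall fun t => ?_)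
  exact (radialExt_coe sqrt_two_pos f (frameFlow i x t)).symm

end Calculus

/-! ### The maximum principle -/

lemma along_frame_sq_nonpos {u : S3 → ℝ} (hu : IsSmooth u) {x : S3} (hx : ∀ y, u y ≤ u x)
    (i : Fin 3) : along (frame i) (along (frame i) u) x ≤ 0 := by
  have h1 := hasDerivAt_comp_frameFlow hu i x
  have h2 := hasDerivAt_comp_frameFlow ((isSmooth_frame i).along sqrt_two_pos hu) i x 0
  have hd : deriv (fun s => u (frameFlow i x s)) = fun s => along (frame i) u (frameFlow i x s) :=
    funext fun s => (h1 s).deriv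
  have hmax : IsLocalMax (fun s => u (frameFlow i x s)) 0 :=
    Filter.Eventually.of_forall fun s => by
      simp only [frameFlow_zero]
      exact hx _
  by_contra! hpos
  -- A positive second derivative would make the maximum a local minimum too, so `u` would be
  -- locally constant on the curve and the second derivative zero.
  have hmin : IsLocalMin (fun s => u (frameFlow i x s)) 0 := by
    refine isLocalMin_of_deriv_deriv_pos ?_ hmax.deriv_eq_zero (h1 0).continuousAt
    rw [hd, h2.deriv, frameFlow_zero]
    exact hpos
  have hc : (fun s => u (frameFlow i x s)) =ᶠ[nhds 0] fun _ => u (frameFlow i x 0) := by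
    filter_upwards [hmax, hmin] with s hs hs'
    exact le_antisymm hs hs'
  have h3 := hc.deriv.deriv_eq
  rw [hd, h2.deriv, frameFlow_zero] at h3
  simp at h3
  exact hpos.ne' h3

/-- A sum of squares of vector fields of the frame has no positive eigenvalue. -/
lemma eq_zero_of_sum_along_frame_sq {u : S3 → ℝ} (hu : IsSmooth u) {s : Finset (Fin 3)} {c : ℝ}
    (hc : 0 < c) (h : ∀ x, ∑ i ∈ s, along (frame i) (along (frame i) u) x = c * u x) : u = 0 := by
  have key : ∀ v : S3 → ℝ, IsSmooth v →
      (∀ x, ∑ i ∈ s, along (frame i) (along (frame i) v) x = c * v x) → ∀ x, v x ≤ 0 := by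
    intro v hv hvc x
    obtain ⟨y, -, hy⟩ := isCompact_univ.exists_isMaxOn ⟨x, Set.mem_univ x⟩ hv.continuous.continuousOn
    have hy' : ∀ z, v z ≤ v y := fun z => hy (Set.mem_univ z)
    have h1 : c * v y ≤ 0 := hvc y ▸ Finset.sum_nonpos fun i _ => along_frame_sq_nonpos hv hy' i
    exact (hy' x).trans (nonpos_of_mul_nonpos_right h1 hc)
  funext x
  refine le_antisymm (key u hu h x) ?_
  -- The equation is linear, so the upper bound for `-u` gives the lower bound for `u`.
  have h1 := key ((-1 : ℝ) • u) (hu.const_smul _) (fun x => ?_) x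
  · simpa using h1
  · have h2 := fun i => (isSmooth_frame i).along sqrt_two_pos hu
    simp only [along_smul sqrt_two_pos _ _ hu, along_smul sqrt_two_pos _ _ (h2 _), Pi.smul_apply]
    rw [← Finset.smul_sum, h x, smul_eq_mul, smul_eq_mul]
    ring

/-! ### The Jacobi operator in the frame `dψ(X₂)`, `dψ(X₃)` -/

/-- All the maps differentiated below are quadratic forms in the coordinates, so their expansion
along a line stops at `t ^ 2` and the derivative is read off as the coefficient of `t`. -/
lemma along_frame_of_expansion {F : Type*} [NormedAddCommGroup F] [NormedSpace ℝ F]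
    {f : S3 → F} {g : EuclideanSpace ℝ (Fin 4) → F} (h : ∀ x, f x = g x) (hg : ContDiff ℝ ∞ g)
    (i : Fin 3) (x : S3) {a b : F}
    (hab : ∀ t : ℝ, g (x + t • frameCLM i x) = g x + t • a + t ^ 2 • b) :
    along (frame i) f x = a := by
  have hd : DifferentiableAt ℝ g x := hg.contDiffAt.differentiableAt (by simp)
  rw [along_frame_comp h i x hd]
  have h1 : HasDerivAt (fun t : ℝ => (x : EuclideanSpace ℝ (Fin 4)) + t • frameCLM i x)
      (frameCLM i x) 0 := by
    simpa using ((hasDerivAt_id (0 : ℝ)).smul_const (frameCLM i x)).const_add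
      (x : EuclideanSpace ℝ (Fin 4))
  have h2 := HasFDerivAt.comp_hasDerivAt
    (f := fun t : ℝ => (x : EuclideanSpace ℝ (Fin 4)) + t • frameCLM i x) 0
    (by simpa using hd.hasFDerivAt) h1
  have h3 : HasDerivAt (fun t : ℝ => g x + t • a + t ^ 2 • b) a 0 := by
    have h4 := (((hasDerivAt_id (0 : ℝ)).smul_const a).const_add (g x)).add
      ((hasDerivAt_pow 2 (0 : ℝ)).smul_const b)
    simp only [id_eq, one_smul] at h4
    refine HasDerivAt.congr_deriv h4 ?_
    simp
  exact h2.unique (h3.congr_of_eventuallyEq (Filter.Eventually.of_forall hab))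

/-! ### The differential of the Hopf map in coordinates -/

/-- The formula of `dψ(X₂)`, on all of `ℝ⁴`. -/
def dHopfFormulaOne (x : EuclideanSpace ℝ (Fin 4)) : EuclideanSpace ℝ (Fin 3) :=
  !₂[((x 0) ^ 2 - (x 1) ^ 2 - (x 2) ^ 2 + (x 3) ^ 2) / 2, x 0 * x 1 + x 2 * x 3,
    x 1 * x 3 - x 0 * x 2]

/-- The formula of `dψ(X₃)`, on all of `ℝ⁴`. -/
def dHopfFormulaTwo (x : EuclideanSpace ℝ (Fin 4)) : EuclideanSpace ℝ (Fin 3) :=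
  !₂[x 0 * x 1 - x 2 * x 3, ((x 1) ^ 2 - (x 0) ^ 2 - (x 2) ^ 2 + (x 3) ^ 2) / 2,
    -(x 0 * x 3 + x 1 * x 2)]

lemma contDiff_dHopfFormulaOne : ContDiff ℝ ∞ dHopfFormulaOne := by
  unfold dHopfFormulaOne
  rw [contDiff_euclidean]
  intro i
  fin_cases i <;> simp <;> fun_prop

lemma contDiff_dHopfFormulaTwo : ContDiff ℝ ∞ dHopfFormulaTwo := by
  unfold dHopfFormulaTwo
  rw [contDiff_euclidean]
  intro i
  fin_cases i <;> simp <;> fun_prop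

lemma dHopf_frame_zero (x : S3) : dHopf (frame 0) x = 0 := by
  have hs := sq_sqrt_two
  have hp := sqrt_two_pos.ne'
  -- The coefficient `b` is the quadratic form at `X₁(x) = ix/√2`; the Hopf formula is invariant
  -- under multiplication by `i`, which leaves the factor `1/2`.
  refine along_frame_of_expansion (g := hopfFormula) (fun _ => rfl) contDiff_hopfFormula 0 x
    (b := (1 / 2 : ℝ) • hopfFormula x) fun t => ?_
  ext j
  fin_cases j <;> simp [hopfFormula, frameCLM_zero_apply] <;> field_simp <;>
    simp only [hs] <;> ring_nf <;> simp only [hs] <;> ring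

lemma dHopf_frame_one (x : S3) : dHopf (frame 1) x = dHopfFormulaOne x := by
  have hs := sq_sqrt_two
  have hp := sqrt_two_pos.ne'
  -- Here `√2 X₂(x) = (-w̄, z̄)` lies over the antipode of `ψ(x)`, whence the sign of `b`. The same
  -- holds for `X₃(x) = iX₂(x)`.
  refine along_frame_of_expansion (g := hopfFormula) (fun _ => rfl) contDiff_hopfFormula 1 x
    (b := -(1 / 2 : ℝ) • hopfFormula x) fun t => ?_
  ext j
  fin_cases j <;> simp [hopfFormula, dHopfFormulaOne, frameCLM_one_apply] <;> field_simp <;>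
    simp only [hs] <;> ring_nf <;> simp only [hs] <;> ring

lemma dHopf_frame_two (x : S3) : dHopf (frame 2) x = dHopfFormulaTwo x := by
  have hs := sq_sqrt_two
  have hp := sqrt_two_pos.ne'
  refine along_frame_of_expansion (g := hopfFormula) (fun _ => rfl) contDiff_hopfFormula 2 x
    (b := -(1 / 2 : ℝ) • hopfFormula x) fun t => ?_
  ext j
  fin_cases j <;> simp [hopfFormula, dHopfFormulaTwo, frameCLM_two_apply] <;> field_simp <;>
    simp only [hs] <;> ring_nf <;> simp only [hs] <;> ring

/-- As `X₁ψ = 0`, one has `X₁X₂ψ = [X₁, X₂]ψ = -√2 X₃ψ`. This rotation along the fibre is the source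
of the first order coupling in the Jacobi operator. -/
lemma along_frame_zero_dHopf_one :
    along (frame 0) (dHopf (frame 1)) = -(√2 • dHopf (frame 2)) := by
  have hs := sq_sqrt_two
  have hp := sqrt_two_pos.ne'
  funext x
  simp only [Pi.neg_apply, Pi.smul_apply, dHopf_frame_two]
  refine along_frame_of_expansion dHopf_frame_one contDiff_dHopfFormulaOne 0 x
    (b := dHopfFormulaOne (frameCLM 0 x)) fun t => ?_
  ext j
  fin_cases j <;> simp [dHopfFormulaOne, dHopfFormulaTwo, frameCLM_zero_apply] <;> field_simp <;>
    simp only [hs] <;> ring_nf <;> simp only [hs] <;> ring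

lemma along_frame_zero_dHopf_two :
    along (frame 0) (dHopf (frame 2)) = √2 • dHopf (frame 1) := by
  have hs := sq_sqrt_two
  have hp := sqrt_two_pos.ne'
  funext x
  simp only [Pi.smul_apply, dHopf_frame_one]
  refine along_frame_of_expansion dHopf_frame_two contDiff_dHopfFormulaTwo 0 x
    (b := dHopfFormulaTwo (frameCLM 0 x)) fun t => ?_
  ext j
  fin_cases j <;> simp [dHopfFormulaOne, dHopfFormulaTwo, frameCLM_zero_apply] <;> field_simp <;>
    simp only [hs] <;> ring_nf <;> simp only [hs] <;> ring

/-- The Hopf map sends the integral curves of `X₂` to unit speed great circles of radius `1/√2`,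
whose acceleration `-2ψ` is normal and disappears in the pull-back connection. -/
lemma along_frame_one_dHopf_one :
    along (frame 1) (dHopf (frame 1)) =
      fun x => -((2 : ℝ) • (hopf x : EuclideanSpace ℝ (Fin 3))) := by
  have hs := sq_sqrt_two
  have hp := sqrt_two_pos.ne'
  funext x
  refine along_frame_of_expansion dHopf_frame_one contDiff_dHopfFormulaOne 1 x
    (b := dHopfFormulaOne (frameCLM 1 x)) fun t => ?_
  ext j
  fin_cases j <;> simp [dHopfFormulaOne, hopf, hopfFormula,
    frameCLM_one_apply] <;> field_simp <;>
    ring_nf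

lemma along_frame_two_dHopf_two :
    along (frame 2) (dHopf (frame 2)) =
      fun x => -((2 : ℝ) • (hopf x : EuclideanSpace ℝ (Fin 3))) := by
  have hs := sq_sqrt_two
  have hp := sqrt_two_pos.ne'
  funext x
  refine along_frame_of_expansion dHopf_frame_two contDiff_dHopfFormulaTwo 2 x
    (b := dHopfFormulaTwo (frameCLM 2 x)) fun t => ?_
  ext j
  fin_cases j <;> simp [dHopfFormulaTwo, hopf, hopfFormula,
    frameCLM_two_apply] <;> field_simp <;>
    ring_nf

lemma along_frame_one_dHopf_two :
    along (frame 1) (dHopf (frame 2)) = 0 := by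
  have hs := sq_sqrt_two
  have hp := sqrt_two_pos.ne'
  funext x
  refine along_frame_of_expansion dHopf_frame_two contDiff_dHopfFormulaTwo 1 x
    (b := dHopfFormulaTwo (frameCLM 1 x)) fun t => ?_
  ext j
  fin_cases j <;> simp [dHopfFormulaTwo, frameCLM_one_apply] <;> field_simp <;>
    simp only [hs] <;> ring_nf <;> simp only [hs] <;> ring

lemma along_frame_two_dHopf_one :
    along (frame 2) (dHopf (frame 1)) = 0 := by
  have hs := sq_sqrt_two
  have hp := sqrt_two_pos.ne'
  funext x
  refine along_frame_of_expansion dHopf_frame_one contDiff_dHopfFormulaOne 2 x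
    (b := dHopfFormulaOne (frameCLM 2 x)) fun t => ?_
  ext j
  fin_cases j <;> simp [dHopfFormulaOne, frameCLM_two_apply] <;> field_simp <;>
    simp only [hs] <;> ring_nf <;> simp only [hs] <;> ring

lemma inner_dHopf_one_one (x : S3) : ⟪dHopf (frame 1) x, dHopf (frame 1) x⟫ = 1 := by
  rw [dHopf_frame_one]
  rw [PiLp.inner_apply, Fin.sum_univ_three]
  simp [dHopfFormulaOne, div_pow, sq_abs]
  -- The squared norm of the formula is `‖x‖⁴/4`, and `N²/4 - 1 = (N + 2)/4 * (N - 2)` with `N =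
  -- ‖x‖²`.
  linear_combination ((x.1 0 ^ 2 + x.1 1 ^ 2 + x.1 2 ^ 2 + x.1 3 ^ 2 + 2) / 4) * sum_sq x

lemma inner_dHopf_two_two (x : S3) : ⟪dHopf (frame 2) x, dHopf (frame 2) x⟫ = 1 := by
  rw [dHopf_frame_two]
  rw [PiLp.inner_apply, Fin.sum_univ_three]
  simp [dHopfFormulaTwo, div_pow, sq_abs]
  linear_combination ((x.1 0 ^ 2 + x.1 1 ^ 2 + x.1 2 ^ 2 + x.1 3 ^ 2 + 2) / 4) * sum_sq x

lemma inner_dHopf_one_two (x : S3) : ⟪dHopf (frame 1) x, dHopf (frame 2) x⟫ = 0 := by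
  rw [dHopf_frame_one, dHopf_frame_two]
  simp [dHopfFormulaOne, dHopfFormulaTwo, PiLp.inner_apply, Fin.sum_univ_three]
  ring

lemma inner_dHopf_two_one (x : S3) : ⟪dHopf (frame 2) x, dHopf (frame 1) x⟫ = 0 := by
  rw [real_inner_comm, inner_dHopf_one_two]

/-! ### Sections as pairs of functions -/

/-- The section `f₂ dψ(X₂) + f₃ dψ(X₃)`. -/
def frameSection : SmoothFun × SmoothFun →ₗ[ℝ] Sections :=
  (mulSection (dHopfFrame 1)).coprod (mulSection (dHopfFrame 2))

lemma frameSection_apply (f g : SmoothFun) :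
    frameSection (f, g) = mulSection (dHopfFrame 1) f + mulSection (dHopfFrame 2) g := rfl

lemma frameSection_apply_apply (f g : SmoothFun) (x : S3) :
    (frameSection (f, g)).1 x = f.1 x • dHopf (frame 1) x + g.1 x • dHopf (frame 2) x := rfl

lemma frameSection_injective : Function.Injective frameSection := by
  rw [injective_iff_map_eq_zero]
  rintro ⟨f, g⟩ h
  have hx : ∀ x, f.1 x • dHopf (frame 1) x + g.1 x • dHopf (frame 2) x = 0 := fun x => by
    rw [← frameSection_apply_apply, h]
    rfl
  refine Prod.ext (Subtype.ext (funext fun x => ?_)) (Subtype.ext (funext fun x => ?_))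
  · change _ = (0 : ℝ)
    have h1 := congrArg (fun v => ⟪v, dHopf (frame 1) x⟫) (hx x)
    simpa only [inner_add_left, real_inner_smul_left, inner_dHopf_one_one, inner_dHopf_two_one,
      mul_one, mul_zero, add_zero, inner_zero_left] using h1
  · change _ = (0 : ℝ)
    have h1 := congrArg (fun v => ⟪v, dHopf (frame 2) x⟫) (hx x)
    simpa only [inner_add_left, real_inner_smul_left, inner_dHopf_two_two, inner_dHopf_one_two,
      mul_one, mul_zero, zero_add, inner_zero_left] using h1

lemma along_frameSection (i : Fin 3) (f g : SmoothFun) (x : S3) :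
    along (frame i) (frameSection (f, g)).1 x
      = (frameSection (deriveFrame i f, deriveFrame i g)).1 x
        + (f.1 x • along (frame i) (dHopf (frame 1)) x
          + g.1 x • along (frame i) (dHopf (frame 2)) x) := by
  have h1 := f.2.smul sqrt_two_pos (dHopfFrame 1).2.1
  have h2 := g.2.smul sqrt_two_pos (dHopfFrame 2).2.1
  have h3 : (frameSection (f, g)).1 = (fun x => f.1 x • (dHopfFrame 1).1 x)
      + fun x => g.1 x • (dHopfFrame 2).1 x := rfl
  rw [h3, along_add sqrt_two_pos _ h1 h2, along_fun_smul f.2 (dHopfFrame 1).2.1,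
    along_fun_smul g.2 (dHopfFrame 2).2.1]
  exact add_add_add_comm _ _ _ _

lemma pullConn_frame_zero (f g : SmoothFun) :
    pullConn (frame 0) (frameSection (f, g)).1
      = (frameSection (deriveFrame 0 f + √2 • g, deriveFrame 0 g - √2 • f)).1 := by
  funext x
  have h : along (frame 0) (frameSection (f, g)).1 x
      = (frameSection (deriveFrame 0 f + √2 • g, deriveFrame 0 g - √2 • f)).1 x := by
    rw [along_frameSection, along_frame_zero_dHopf_one, along_frame_zero_dHopf_two]
    simp only [frameSection_apply_apply, Pi.neg_apply, Pi.smul_apply, Submodule.coe_add,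
      Submodule.coe_sub, Submodule.coe_smul, Pi.add_apply, Pi.sub_apply, smul_eq_mul]
    module
  rw [pullConn, h, tanProj_of_inner_eq_zero ((frameSection _).2.2 x)]

lemma pullConn_frame_one (f g : SmoothFun) :
    pullConn (frame 1) (frameSection (f, g)).1
      = (frameSection (deriveFrame 1 f, deriveFrame 1 g)).1 := by
  funext x
  rw [pullConn, along_frameSection, along_frame_one_dHopf_one, along_frame_one_dHopf_two,
    tanProj_add, tanProj_of_inner_eq_zero ((frameSection _).2.2 x), Pi.zero_apply, smul_zero,
    add_zero, smul_neg, smul_smul, ← neg_smul, tanProj_smul, tanProj_self (hopf_ne_zero x),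
    smul_zero, add_zero]

lemma pullConn_frame_two (f g : SmoothFun) :
    pullConn (frame 2) (frameSection (f, g)).1
      = (frameSection (deriveFrame 2 f, deriveFrame 2 g)).1 := by
  funext x
  rw [pullConn, along_frameSection, along_frame_two_dHopf_one, along_frame_two_dHopf_two,
    tanProj_add, tanProj_of_inner_eq_zero ((frameSection _).2.2 x), Pi.zero_apply, smul_zero,
    zero_add, smul_neg, smul_smul, ← neg_smul, tanProj_smul, tanProj_self (hopf_ne_zero x),
    smul_zero, add_zero]

lemma pullConn_zero (V : S3 → EuclideanSpace ℝ (Fin 3)) : pullConn 0 V = 0 := by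
  funext x
  simp [pullConn, along_zero, tanProj]

/-- The vectors `dψ(X₂), dψ(X₃)` form an orthonormal basis of the tangent plane and `dψ(X₁) = 0`, so
the trace is minus the Ricci operator of a surface of curvature `2`. -/
lemma curvatureTerm_frameSection (f g : SmoothFun) :
    curvatureTerm (frameSection (f, g)).1 = (frameSection (-(2 : ℝ) • f, -(2 : ℝ) • g)).1 := by
  funext x
  have h : ((1 / √2) ^ 2)⁻¹ = (2 : ℝ) := by
    rw [div_pow, sq_sqrt_two]
    norm_num
  rw [curvatureTerm_eq (frameSection (f, g)), h, Fin.sum_univ_three, dHopf_frame_zero]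
  simp only [frameSection_apply_apply, inner_add_left, real_inner_smul_left, inner_dHopf_one_one,
    inner_dHopf_one_two, inner_dHopf_two_one, inner_dHopf_two_two, inner_zero_right,
    Submodule.coe_smul, Pi.smul_apply, smul_eq_mul]
  module

lemma laplace_eq (f : SmoothFun) :
    laplace f = -(deriveFrame 0 (deriveFrame 0 f) + deriveFrame 1 (deriveFrame 1 f)
      + deriveFrame 2 (deriveFrame 2 f)) := by
  refine Subtype.ext ?_
  change laplaceFun f = _
  simp only [laplaceFun, leviCivita_frame_self, along_zero, sub_zero, Fin.sum_univ_three]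
  rfl

lemma vertLaplace_eq (f : SmoothFun) : vertLaplace f = -deriveFrame 0 (deriveFrame 0 f) :=
  Subtype.ext (vertLaplaceFun_eq f.2)

/-- The Jacobi operator in the frame `dψ(X₂)`, `dψ(X₃)`. -/
lemma jacobi_frameSection (f g : SmoothFun) :
    jacobi (frameSection (f, g)) = frameSection
      (laplace f - (2 * √2) • deriveFrame 0 g, laplace g + (2 * √2) • deriveFrame 0 f) := by
  have hs : √2 * √2 = (2 : ℝ) := Real.mul_self_sqrt (by norm_num)
  have h : jacobi (frameSection (f, g)) =
      -(frameSection (deriveFrame 0 (deriveFrame 0 f + √2 • g) + √2 • (deriveFrame 0 g - √2 • f),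
          deriveFrame 0 (deriveFrame 0 g - √2 • f) - √2 • (deriveFrame 0 f + √2 • g))
        + frameSection (deriveFrame 1 (deriveFrame 1 f), deriveFrame 1 (deriveFrame 1 g))
        + frameSection (deriveFrame 2 (deriveFrame 2 f), deriveFrame 2 (deriveFrame 2 g)))
      + frameSection (-(2 : ℝ) • f, -(2 : ℝ) • g) := by
    refine Subtype.ext ?_
    change jacobiFun (frameSection (f, g)).1 = _
    simp only [jacobiFun, roughLaplaceFun, Fin.sum_univ_three, leviCivita_frame_self,
      pullConn_zero, sub_zero, pullConn_frame_zero, pullConn_frame_one, pullConn_frame_two,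
      curvatureTerm_frameSection]
    rfl
  rw [h, ← map_add, ← map_add, ← map_neg, ← map_add, laplace_eq, laplace_eq]
  congr 1
  refine Prod.ext ?_ ?_
  · simp only [Prod.fst_add, Prod.fst_neg, map_add, map_smul, smul_sub, smul_smul, hs]
    module
  · simp only [Prod.snd_add, Prod.snd_neg, map_sub, map_smul, smul_add, smul_smul, hs]
    module

lemma deriveFrame_comm (i : Fin 3) (f : SmoothFun) :
    deriveFrame i (deriveFrame (i + 1) f) - deriveFrame (i + 1) (deriveFrame i f)
      = -(√2 • deriveFrame (i + 2) f) :=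
  Subtype.ext (along_frame_comm f.2 i)

/-- The Laplacian is minus the Casimir operator of the frame: `[X₁, X₂²] = -√2 (X₂X₃ + X₃X₂)` and
`[X₁, X₃²]` is its negative. -/
lemma laplace_deriveFrame_zero (f : SmoothFun) :
    laplace (deriveFrame 0 f) = deriveFrame 0 (laplace f) := by
  have h01 := deriveFrame_comm 0
  have h20 := deriveFrame_comm 2
  simp only [zero_add, Fin.reduceAdd] at h01 h20
  have h1 := h01 (deriveFrame 1 f)
  have h2 := congrArg (deriveFrame 1) (h01 f)
  have h3 := h20 (deriveFrame 2 f)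
  have h4 := congrArg (deriveFrame 2) (h20 f)
  simp only [map_sub, map_neg, map_smul] at h2 h4
  rw [laplace_eq, laplace_eq, map_neg, map_add, map_add]
  linear_combination (norm := module) h1 + h2 - h3 - h4

/-! ### Complex valued eigenfunctions and their weights -/

/-- Smooth complex valued functions on `S³(√2)`. -/
def ComplexFun : Submodule ℂ (S3 → ℂ) where
  carrier := {h | IsSmooth h}
  add_mem' := IsSmooth.add
  zero_mem' := isSmooth_zero
  smul_mem' c _ hh := hh.clm_comp (ContinuousLinearMap.mul ℝ ℂ c)

/-- The derivative along a vector field of the frame, on complex valued functions. -/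
def complexDeriv (i : Fin 3) : ComplexFun →ₗ[ℂ] ComplexFun where
  toFun h := ⟨along (frame i) h, (isSmooth_frame i).along sqrt_two_pos h.2⟩
  map_add' h g := Subtype.ext (along_add sqrt_two_pos _ h.2 g.2)
  map_smul' c h := Subtype.ext (along_clm_comp (ContinuousLinearMap.mul ℝ ℂ c) h.2 _)

lemma complexDeriv_comm (i : Fin 3) (h : ComplexFun) :
    complexDeriv i (complexDeriv (i + 1) h) - complexDeriv (i + 1) (complexDeriv i h)
      = -((√2 : ℂ) • complexDeriv (i + 2) h) := by
  refine Subtype.ext ((along_frame_comm h.2 i).trans ?_)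
  funext x
  simp [complexDeriv]

/-- The Laplacian on complex valued functions. -/
def complexLaplace : ComplexFun →ₗ[ℂ] ComplexFun :=
  -∑ i, complexDeriv i ∘ₗ complexDeriv i

lemma complexLaplace_apply (h : ComplexFun) :
    complexLaplace h = -(complexDeriv 0 (complexDeriv 0 h) + complexDeriv 1 (complexDeriv 1 h)
      + complexDeriv 2 (complexDeriv 2 h)) := by
  simp [complexLaplace, Fin.sum_univ_three]

lemma complexLaplace_complexDeriv (i : Fin 3) (h : ComplexFun) :
    complexLaplace (complexDeriv i h) = complexDeriv i (complexLaplace h) := by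
  have hl : ∀ g, complexLaplace g = -(complexDeriv i (complexDeriv i g)
      + complexDeriv (i + 1) (complexDeriv (i + 1) g)
      + complexDeriv (i + 2) (complexDeriv (i + 2) g)) := by
    intro g
    rw [complexLaplace_apply]
    fin_cases i <;> simp <;> abel
  have hi1 : i + 2 + 1 = i := by fin_cases i <;> rfl
  have hi2 : i + 2 + 2 = i + 1 := by fin_cases i <;> rfl
  have h1 := complexDeriv_comm i (complexDeriv (i + 1) h)
  have h2 := congrArg (complexDeriv (i + 1)) (complexDeriv_comm i h)
  have h3 := complexDeriv_comm (i + 2) (complexDeriv (i + 2) h)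
  have h4 := congrArg (complexDeriv (i + 2)) (complexDeriv_comm (i + 2) h)
  rw [hi1, hi2] at h3 h4
  simp only [map_sub, map_neg, map_smul] at h2 h4
  rw [hl, hl, map_neg, map_add, map_add]
  linear_combination (norm := module) h1 + h2 - h3 - h4

/-! ### Ladder operators -/

/-- The raising operator `X₂ + i X₃`. -/
def raising : ComplexFun →ₗ[ℂ] ComplexFun := complexDeriv 1 + Complex.I • complexDeriv 2

/-- The lowering operator `X₂ - i X₃`. -/
def lowering : ComplexFun →ₗ[ℂ] ComplexFun := complexDeriv 1 - Complex.I • complexDeriv 2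

lemma raising_apply (h : ComplexFun) :
    raising h = complexDeriv 1 h + Complex.I • complexDeriv 2 h := rfl

lemma lowering_apply (h : ComplexFun) :
    lowering h = complexDeriv 1 h - Complex.I • complexDeriv 2 h := rfl

lemma complexLaplace_raising (h : ComplexFun) :
    complexLaplace (raising h) = raising (complexLaplace h) := by
  simp only [raising_apply, map_add, map_smul, complexLaplace_complexDeriv]

lemma complexLaplace_lowering (h : ComplexFun) :
    complexLaplace (lowering h) = lowering (complexLaplace h) := by
  simp only [lowering_apply, map_sub, map_smul, complexLaplace_complexDeriv]

lemma I_smul_I_smul (h : ComplexFun) : Complex.I • Complex.I • h = -h := by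
  rw [smul_smul, Complex.I_mul_I, neg_one_smul]

/-- From `[X₁, X₂] = -√2 X₃` and `[X₁, X₃] = √2 X₂` it follows that `[X₁, X₂ + iX₃] = i√2 (X₂ +
iX₃)`. Since `√2 = 2/√2`, weights in units of `i/√2` move by `2`. -/
lemma complexDeriv_zero_raising (h : ComplexFun) :
    complexDeriv 0 (raising h)
      = raising (complexDeriv 0 h) + (Complex.I * (√2 : ℂ)) • raising h := by
  have h1 := complexDeriv_comm 0 h
  have h2 := complexDeriv_comm 2 h
  simp only [zero_add, Fin.reduceAdd] at h1 h2
  simp only [raising_apply, map_add, map_smul]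
  linear_combination (norm := module) h1 - Complex.I • h2
    - (√2 : ℂ) • I_smul_I_smul (complexDeriv 2 h)

lemma complexDeriv_zero_lowering (h : ComplexFun) :
    complexDeriv 0 (lowering h)
      = lowering (complexDeriv 0 h) - (Complex.I * (√2 : ℂ)) • lowering h := by
  have h1 := complexDeriv_comm 0 h
  have h2 := complexDeriv_comm 2 h
  simp only [zero_add, Fin.reduceAdd] at h1 h2
  simp only [lowering_apply, map_sub, map_smul]
  linear_combination (norm := module) h1 + Complex.I • h2
    - (√2 : ℂ) • I_smul_I_smul (complexDeriv 2 h)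

/-- The product is `X₂² + X₃² + i[X₂, X₃]`, where `X₂² + X₃² = -Δ - X₁²` and `[X₂, X₃] = -√2 X₁`. On
a weight space it is therefore a scalar. -/
lemma lowering_raising (h : ComplexFun) :
    lowering (raising h) = -complexLaplace h - complexDeriv 0 (complexDeriv 0 h)
      - (Complex.I * (√2 : ℂ)) • complexDeriv 0 h := by
  have h1 := complexDeriv_comm 1 h
  simp only [Fin.reduceAdd] at h1
  rw [complexLaplace_apply]
  simp only [lowering_apply, raising_apply, map_add, map_smul]
  linear_combination (norm := module) Complex.I • h1
    - I_smul_I_smul (complexDeriv 2 (complexDeriv 2 h))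

lemma raising_lowering (h : ComplexFun) :
    raising (lowering h) = -complexLaplace h - complexDeriv 0 (complexDeriv 0 h)
      + (Complex.I * (√2 : ℂ)) • complexDeriv 0 h := by
  have h1 := complexDeriv_comm 1 h
  simp only [Fin.reduceAdd] at h1
  rw [complexLaplace_apply]
  simp only [lowering_apply, raising_apply, map_sub, map_smul]
  linear_combination (norm := module) (-Complex.I) • h1
    - I_smul_I_smul (complexDeriv 2 (complexDeriv 2 h))

/-! ### Weight spaces and their dimensions -/

/-- The complex valued solutions `h` of `Δ h = λ_k h` and `X₁ h = (i m / √2) h`. -/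
def weightSpace (k : ℕ) (m : ℝ) : Submodule ℂ ComplexFun :=
  Module.End.eigenspace complexLaplace (lam k : ℂ) ⊓
    Module.End.eigenspace (complexDeriv 0) (Complex.I * (m / √2 : ℝ))

lemma mem_weightSpace {k : ℕ} {m : ℝ} {h : ComplexFun} :
    h ∈ weightSpace k m ↔ complexLaplace h = (lam k : ℂ) • h ∧
      complexDeriv 0 h = (Complex.I * (m / √2 : ℝ)) • h := by
  rw [weightSpace, Submodule.mem_inf, Module.End.mem_eigenspace_iff, Module.End.mem_eigenspace_iff]

lemma ofReal_sqrt_two_mul_self : (√2 : ℂ) * (√2 : ℂ) = 2 := by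
  rw [← Complex.ofReal_mul, Real.mul_self_sqrt (by norm_num)]
  norm_num

lemma ofReal_sqrt_two_ne_zero : (√2 : ℂ) ≠ 0 := Complex.ofReal_ne_zero.2 sqrt_two_pos.ne'

lemma raising_mem {k : ℕ} {m : ℝ} {h : ComplexFun} (hh : h ∈ weightSpace k m) :
    raising h ∈ weightSpace k (m + 2) := by
  rw [mem_weightSpace] at hh ⊢
  refine ⟨by rw [complexLaplace_raising, hh.1, map_smul], ?_⟩
  rw [complexDeriv_zero_raising, hh.2, map_smul, ← add_smul]
  congr 1
  push_cast
  field_simp [ofReal_sqrt_two_ne_zero]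
  linear_combination ofReal_sqrt_two_mul_self

lemma lowering_mem {k : ℕ} {m : ℝ} {h : ComplexFun} (hh : h ∈ weightSpace k (m + 2)) :
    lowering h ∈ weightSpace k m := by
  rw [mem_weightSpace] at hh ⊢
  refine ⟨by rw [complexLaplace_lowering, hh.1, map_smul], ?_⟩
  rw [complexDeriv_zero_lowering, hh.2, map_smul, sub_eq_iff_eq_add, ← add_smul]
  congr 1
  push_cast
  field_simp [ofReal_sqrt_two_ne_zero]
  linear_combination -ofReal_sqrt_two_mul_self

lemma I_mul_div_sqrt_two_sq (m : ℝ) :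
    (Complex.I * (m / √2 : ℝ)) * (Complex.I * (m / √2 : ℝ)) = -((m ^ 2 / 2 : ℝ) : ℂ) := by
  have h : (m / √2) * (m / √2) = m ^ 2 / 2 := by
    rw [div_mul_div_comm, Real.mul_self_sqrt (by norm_num), sq]
  rw [mul_mul_mul_comm, Complex.I_mul_I, ← Complex.ofReal_mul, h, neg_one_mul]

lemma I_mul_sqrt_two_mul (m : ℝ) :
    (Complex.I * (√2 : ℂ)) * (Complex.I * (m / √2 : ℝ)) = -(m : ℂ) := by
  have h : √2 * (m / √2) = m := mul_div_cancel₀ m sqrt_two_pos.ne'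
  rw [mul_mul_mul_comm, Complex.I_mul_I, ← Complex.ofReal_mul, h, neg_one_mul]

lemma lowering_raising_of_mem {k : ℕ} {m : ℝ} {h : ComplexFun} (hh : h ∈ weightSpace k m) :
    lowering (raising h) = ((m ^ 2 / 2 + m - lam k : ℝ) : ℂ) • h := by
  rw [mem_weightSpace] at hh
  rw [lowering_raising, hh.1, hh.2, map_smul, hh.2, smul_smul, smul_smul, I_mul_div_sqrt_two_sq,
    I_mul_sqrt_two_mul]
  push_cast
  module

lemma raising_lowering_of_mem {k : ℕ} {m : ℝ} {h : ComplexFun} (hh : h ∈ weightSpace k m) :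
    raising (lowering h) = ((m ^ 2 / 2 - m - lam k : ℝ) : ℂ) • h := by
  rw [mem_weightSpace] at hh
  rw [raising_lowering, hh.1, hh.2, map_smul, hh.2, smul_smul, smul_smul, I_mul_div_sqrt_two_sq,
    I_mul_sqrt_two_mul]
  push_cast
  module

/-- A function of weight `k` that is annihilated by the raising operator is a `λ_k`-eigenfunction
of the Laplacian. -/
lemma mem_weightSpace_of_raising_eq_zero {k : ℕ} {h : ComplexFun}
    (h0 : complexDeriv 0 h = (Complex.I * ((k : ℝ) / √2 : ℝ)) • h) (h1 : raising h = 0) :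
    h ∈ weightSpace k k := by
  refine mem_weightSpace.2 ⟨?_, h0⟩
  -- With the left side zero this reads `Δh = (k²/2 + k) h`, and `k²/2 + k = λ_k`.
  have h2 := lowering_raising h
  rw [h1, map_zero, h0, map_smul, h0, smul_smul, smul_smul, I_mul_div_sqrt_two_sq,
    I_mul_sqrt_two_mul] at h2
  rw [lam]
  push_cast at h2 ⊢
  linear_combination (norm := module) h2

lemma along_frame_sq_comp_complexFun (T : ℂ →L[ℝ] ℝ) (h : ComplexFun) (i : Fin 3) :
    along (frame i) (along (frame i) fun x => T (h.1 x))
      = fun x => T ((complexDeriv i (complexDeriv i h)).1 x) := by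
  rw [along_clm_comp T h.2]
  exact along_clm_comp T (complexDeriv i h).2 _

/-- The weights `m` of the `λ_k`-eigenfunctions satisfy `m ^ 2 / 2 ≤ λ_k`. -/
lemma weightSpace_eq_bot {k : ℕ} {m : ℝ} (hm : lam k < m ^ 2 / 2) : weightSpace k m = ⊥ := by
  rw [Submodule.eq_bot_iff]
  intro h hh
  rw [mem_weightSpace] at hh
  have h1 := complexLaplace_apply h
  rw [hh.1, hh.2, map_smul, hh.2, smul_smul, I_mul_div_sqrt_two_sq] at h1
  -- Removing `X₁²h = -(m²/2) h` from the Laplacian leaves a sum of two squares with a positive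
  -- eigenvalue. The maximum principle then applies to the real and imaginary parts.
  have h2 : complexDeriv 1 (complexDeriv 1 h) + complexDeriv 2 (complexDeriv 2 h)
      = ((m ^ 2 / 2 - lam k : ℝ) : ℂ) • h := by
    push_cast at h1 ⊢
    linear_combination (norm := module) h1
  have key : ∀ T : ℂ →L[ℝ] ℝ, (fun x => T (h.1 x)) = 0 := by
    intro T
    refine eq_zero_of_sum_along_frame_sq (h.2.clm_comp T) (s := {1, 2}) (sub_pos.2 hm) fun x => ?_
    rw [Finset.sum_pair (by decide), along_frame_sq_comp_complexFun,
      along_frame_sq_comp_complexFun, ← map_add, ← smul_eq_mul, ← map_smul]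
    have h3 := congrFun (congrArg Subtype.val h2) x
    exact congrArg T (h3.trans (Complex.coe_smul _ _).symm)
  refine Subtype.ext (funext fun x => Complex.ext ?_ ?_)
  · exact congrFun (key Complex.reCLM) x
  · exact congrFun (key Complex.imCLM) x

/-- The raising operator is an isomorphism between weight spaces as long as the Casimir element
does not vanish. -/
lemma finrank_weightSpace_add_two {k : ℕ} {m : ℝ} (hm : m ^ 2 / 2 + m - lam k ≠ 0) :
    Module.finrank ℂ (weightSpace k m) = Module.finrank ℂ (weightSpace k (m + 2)) := by
  have hc : ((m ^ 2 / 2 + m - lam k : ℝ) : ℂ) ≠ 0 := Complex.ofReal_ne_zero.2 hm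
  refine (LinearEquiv.ofBijective (raising.restrict fun h hh => raising_mem hh) ⟨?_, ?_⟩).finrank_eq
  · rw [injective_iff_map_eq_zero]
    rintro ⟨h, hh⟩ h0
    have h1 : raising h = 0 := congrArg Subtype.val h0
    have h2 := lowering_raising_of_mem hh
    rw [h1, map_zero] at h2
    exact Subtype.ext ((smul_eq_zero.1 h2.symm).resolve_left hc)
  · rintro ⟨g, hg⟩
    refine ⟨⟨_, Submodule.smul_mem _ (((m ^ 2 / 2 + m - lam k : ℝ) : ℂ)⁻¹) (lowering_mem hg)⟩,
      Subtype.ext ?_⟩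
    have h1 := raising_lowering_of_mem hg
    -- Raising after lowering at weight `m + 2` has the same scalar as lowering after raising at
    -- weight `m`, so the rescaled lowering operator is the inverse.
    have h2 : (m + 2) ^ 2 / 2 - (m + 2) - lam k = m ^ 2 / 2 + m - lam k := by ring
    rw [h2] at h1
    change raising (((m ^ 2 / 2 + m - lam k : ℝ) : ℂ)⁻¹ • lowering g) = g
    rw [map_smul, h1, inv_smul_smul₀ hc]

/-- `2λ_k = (k + 1)² - 1` lies just below `(k + 1)²`. -/
lemma weightSpace_eq_bot_of_add_one_le {k : ℕ} {m : ℝ} (hm : (k : ℝ) + 1 ≤ m) :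
    weightSpace k m = ⊥ := by
  refine weightSpace_eq_bot ?_
  have hk : (0 : ℝ) ≤ k := k.cast_nonneg
  rw [lam]
  nlinarith

/-- All nonzero weight spaces have the dimension of the space of highest weight. -/
lemma finrank_weightSpace_of_ne_bot {k : ℕ} {m : ℝ} (hm : weightSpace k m ≠ ⊥) :
    Module.finrank ℂ (weightSpace k m) = Module.finrank ℂ (weightSpace k k) := by
  have hk : (0 : ℝ) ≤ k := k.cast_nonneg
  -- Here `n` bounds the number of raisings that bring `m` to `k + 1` or beyond, where the weight
  -- space is zero. Weights are arbitrary reals at this stage.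
  have key : ∀ (n : ℕ) (m : ℝ), (k : ℝ) + 1 - 2 * n ≤ m → weightSpace k m ≠ ⊥ →
      Module.finrank ℂ (weightSpace k m) = Module.finrank ℂ (weightSpace k k) := by
    intro n
    induction n with
    | zero =>
      intro m hn hm
      exact absurd (weightSpace_eq_bot_of_add_one_le (by simpa using hn)) hm
    | succ n ih =>
      intro m hn hm
      by_cases hmk : m = k
      · rw [hmk]
      have hc : m ^ 2 / 2 + m - lam k ≠ 0 := by
        intro h0
        -- The scalar has the roots `k` and `-(k + 2)`; the second violates the bound `m²/2 ≤ λ_k`.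
        -- So only `m = k` can end the chain of raisings.
        have h1 : (m - k) * (m + k + 2) = 0 := by
          rw [lam] at h0
          linear_combination 2 * h0
        rcases mul_eq_zero.1 h1 with h2 | h2
        · exact hmk (sub_eq_zero.1 h2)
        · refine hm (weightSpace_eq_bot ?_)
          have h3 : m = -(k + 2) := by linarith
          rw [h3, lam]
          nlinarith
      have h2 := finrank_weightSpace_add_two hc
      refine h2.trans (ih (m + 2) ?_ fun h3 => hm ?_)
      · push_cast at hn
        linarith
      · rw [Submodule.eq_bot_iff]
        intro h hh
        have h4 := raising_mem hh
        rw [h3, Submodule.mem_bot] at h4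
        have h5 := lowering_raising_of_mem hh
        rw [h4, map_zero] at h5
        exact (smul_eq_zero.1 h5.symm).resolve_left (Complex.ofReal_ne_zero.2 hc)
  obtain ⟨n, hn⟩ := exists_nat_ge (((k : ℝ) + 1 - m) / 2)
  exact key n m (by linarith) hm

/-! ### Entire functions of polynomial growth -/

/-- The quotient `(g(t) - g(0))/t` is again entire and loses one degree of growth; Liouville's
theorem is the start of the induction. -/
lemma exists_polynomial_of_growth (k : ℕ) : ∀ {g : ℂ → ℂ} {C : ℝ}, Differentiable ℂ g →
    (∀ t, ‖g t‖ ≤ C * (1 + ‖t‖) ^ k) →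
    ∃ p : Polynomial ℂ, p.natDegree ≤ k ∧ ∀ t, g t = p.eval t := by
  induction k with
  | zero =>
    intro g C hg hb
    refine ⟨Polynomial.C (g 0), by simp, fun t => ?_⟩
    rw [Polynomial.eval_C]
    refine hg.apply_eq_apply_of_bounded ?_ t 0
    refine isBounded_iff_forall_norm_le.2 ⟨C, ?_⟩
    rintro _ ⟨t, rfl⟩
    simpa using hb t
  | succ k ih =>
    intro g C hg hb
    have hd : Differentiable ℂ (dslope g 0) := by
      rw [← differentiableOn_univ] at hg ⊢
      exact (Complex.differentiableOn_dslope Filter.univ_mem).2 hg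
    obtain ⟨M, hM⟩ := (isCompact_closedBall (0 : ℂ) 1).exists_bound_of_continuousOn
      hd.continuous.continuousOn
    have hC : 0 ≤ C := (norm_nonneg _).trans ((hb 0).trans (by simp))
    have hM0 : 0 ≤ M := (norm_nonneg _).trans (hM 0 (by simp))
    have hg' : ∀ t, g t = g 0 + t * dslope g 0 t := fun t => by
      have h := sub_smul_dslope g 0 t
      rw [sub_zero, smul_eq_mul] at h
      rw [h]
      ring
    -- `M` bounds the quotient on the closed unit disc. Outside it, `1 + ‖t‖ ≤ 2‖t‖` absorbs the
    -- division by `t`, with room in the constant `4C`.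
    have hb' : ∀ t, ‖dslope g 0 t‖ ≤ (M + 4 * C) * (1 + ‖t‖) ^ k := by
      intro t
      have h1 : 1 ≤ (1 + ‖t‖) ^ k := one_le_pow₀ (by linarith [norm_nonneg t])
      rcases le_total ‖t‖ 1 with ht | ht
      · have h2 := hM t (by simpa using ht)
        nlinarith
      · have h2 : t * dslope g 0 t = g t - g 0 := by rw [hg' t]; ring
        have h3 : ‖t‖ * ‖dslope g 0 t‖ ≤ C * (1 + ‖t‖) ^ (k + 1) + C := by
          rw [← norm_mul, h2]
          refine (norm_sub_le _ _).trans (add_le_add (hb t) ?_)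
          simpa using hb 0
        have h4 : C * (1 + ‖t‖) ^ (k + 1) + C ≤ ‖t‖ * (4 * C * (1 + ‖t‖) ^ k) := by
          have h5 : 0 ≤ C * ((1 + ‖t‖) ^ k - 1) := mul_nonneg hC (by linarith)
          have h6 : 0 ≤ C * (1 + ‖t‖) ^ k * (‖t‖ - 1) :=
            mul_nonneg (mul_nonneg hC (by linarith)) (by linarith)
          rw [pow_succ]
          nlinarith
        have h7 : ‖dslope g 0 t‖ ≤ 4 * C * (1 + ‖t‖) ^ k :=
          le_of_mul_le_mul_left (h3.trans h4) (by linarith)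
        nlinarith
    obtain ⟨p, hp, hpg⟩ := ih hd hb'
    refine ⟨Polynomial.C (g 0) + Polynomial.X * p, ?_, fun t => ?_⟩
    · refine (Polynomial.natDegree_add_le _ _).trans (max_le (by simp) ?_)
      refine Polynomial.natDegree_mul_le.trans ?_
      have := Polynomial.natDegree_X_le (R := ℂ)
      omega
    · rw [hg' t, hpg t]
      simp

/-! ### Functions of highest weight -/

/-- The complex coordinate `z = x¹ + i x²`. -/
def coordZ : EuclideanSpace ℝ (Fin 4) →L[ℝ] ℂ :=
  Complex.ofRealCLM ∘L EuclideanSpace.proj 0 +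
    Complex.I • (Complex.ofRealCLM ∘L EuclideanSpace.proj 1)

/-- The complex coordinate `w = x³ + i x⁴`. -/
def coordW : EuclideanSpace ℝ (Fin 4) →L[ℝ] ℂ :=
  Complex.ofRealCLM ∘L EuclideanSpace.proj 2 +
    Complex.I • (Complex.ofRealCLM ∘L EuclideanSpace.proj 3)

lemma coordZ_apply (y : EuclideanSpace ℝ (Fin 4)) : coordZ y = y 0 + Complex.I * y 1 := by
  simp [coordZ]

lemma coordW_apply (y : EuclideanSpace ℝ (Fin 4)) : coordW y = y 2 + Complex.I * y 3 := by
  simp [coordW]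

lemma coordZ_frameCLM_zero (y : EuclideanSpace ℝ (Fin 4)) :
    coordZ (frameCLM 0 y) = Complex.I * (1 / √2 : ℝ) * coordZ y := by
  simp only [coordZ_apply, frameCLM_zero_apply]
  simp
  linear_combination -(√2 : ℂ)⁻¹ * y 1 * Complex.I_sq

lemma coordW_frameCLM_zero (y : EuclideanSpace ℝ (Fin 4)) :
    coordW (frameCLM 0 y) = Complex.I * (1 / √2 : ℝ) * coordW y := by
  simp only [coordW_apply, frameCLM_zero_apply]
  simp
  linear_combination -(√2 : ℂ)⁻¹ * y 3 * Complex.I_sq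

/-- As vectors `X₃ = iX₂`, so `X₂ + iX₃` kills every complex linear function. -/
lemma coordZ_raising (y : EuclideanSpace ℝ (Fin 4)) :
    coordZ (frameCLM 1 y) + Complex.I * coordZ (frameCLM 2 y) = 0 := by
  simp only [coordZ_apply, frameCLM_one_apply, frameCLM_two_apply]
  simp
  linear_combination -(√2 : ℂ)⁻¹ * y 2 * Complex.I_sq

lemma coordW_raising (y : EuclideanSpace ℝ (Fin 4)) :
    coordW (frameCLM 1 y) + Complex.I * coordW (frameCLM 2 y) = 0 := by
  simp only [coordW_apply, frameCLM_one_apply, frameCLM_two_apply]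
  simp
  linear_combination (√2 : ℂ)⁻¹ * y 0 * Complex.I_sq

/-- The restriction to the sphere of the monomial `z ^ a w ^ b`. -/
def monomialFun (a b : ℕ) : ComplexFun :=
  ⟨fun x => coordZ x ^ a * coordW x ^ b, isSmooth_of_contDiffOn sqrt_two_pos
    (g := fun y => coordZ y ^ a * coordW y ^ b)
    ((coordZ.contDiff.pow a).mul (coordW.contDiff.pow b)).contDiffOn fun _ => rfl⟩

lemma complexDeriv_monomialFun (a b : ℕ) (i : Fin 3) (x : S3) :
    (complexDeriv i (monomialFun a b)).1 x
      = a * coordZ x ^ (a - 1) * coordW x ^ b * coordZ (frameCLM i x)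
        + b * coordZ x ^ a * coordW x ^ (b - 1) * coordW (frameCLM i x) := by
  have h := (coordZ.hasFDerivAt (x := (x : EuclideanSpace ℝ (Fin 4)))).pow a |>.mul
    ((coordW.hasFDerivAt (x := (x : EuclideanSpace ℝ (Fin 4)))).pow b)
  have h1 := along_frame_comp (f := (monomialFun a b).1) (fun _ => rfl) i x h.differentiableAt
  rw [h.fderiv] at h1
  refine h1.trans ?_
  simp
  ring

/-- The raising operator is a derivation killing `z` and `w`, and `X₁` multiplies each of them by
`i/√2`, so a monomial has its degree as weight. -/
lemma monomialFun_mem {k a b : ℕ} (hab : a + b = k) : monomialFun a b ∈ weightSpace k k := by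
  -- For `n = 0` the truncated exponent is harmless because the coefficient vanishes.
  have hp : ∀ (n : ℕ) (u : ℂ), (n : ℂ) * u ^ (n - 1) * u = n * u ^ n := by
    intro n u
    rcases n with _ | n
    · simp
    · rw [Nat.add_sub_cancel, pow_succ, mul_assoc]
  refine mem_weightSpace_of_raising_eq_zero (Subtype.ext (funext fun x => ?_))
    (Subtype.ext (funext fun x => ?_))
  · rw [complexDeriv_monomialFun, coordZ_frameCLM_zero, coordW_frameCLM_zero]
    change _ = Complex.I * ((k : ℝ) / √2 : ℝ) * (coordZ x ^ a * coordW x ^ b)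
    rw [← hab]
    push_cast
    linear_combination Complex.I * (1 / (√2 : ℂ)) * coordW x ^ b * hp a (coordZ x)
      + Complex.I * (1 / (√2 : ℂ)) * coordZ x ^ a * hp b (coordW x)
  · change (complexDeriv 1 (monomialFun a b)).1 x
      + Complex.I * (complexDeriv 2 (monomialFun a b)).1 x = 0
    rw [complexDeriv_monomialFun, complexDeriv_monomialFun]
    linear_combination a * coordZ x ^ (a - 1) * coordW x ^ b * coordZ_raising x
      + b * coordZ x ^ a * coordW x ^ (b - 1) * coordW_raising x

/-- The functions `∑ aⱼ z ^ (k - j) w ^ j`. -/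
def binaryForm (k : ℕ) : (Fin (k + 1) → ℂ) →ₗ[ℂ] weightSpace k k :=
  Fintype.linearCombination ℂ fun j : Fin (k + 1) =>
    (⟨monomialFun (k - j) j, monomialFun_mem (Nat.sub_add_cancel (Nat.lt_succ_iff.1 j.2))⟩ :
      weightSpace k k)

lemma binaryForm_apply (k : ℕ) (a : Fin (k + 1) → ℂ) (x : S3) :
    (binaryForm k a).1.1 x = ∑ j, a j * (coordZ x ^ (k - j : ℕ) * coordW x ^ (j : ℕ)) := by
  simp [binaryForm, Fintype.linearCombination_apply, monomialFun]

/-! ### The homogeneous extension and complex linearity -/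

section Homogeneous

variable {F : Type*} [NormedAddCommGroup F] [NormedSpace ℝ F]

lemma fderiv_radialExt_frameCLM {f : S3 → F} (hf : IsSmooth f) (i : Fin 3)
    {y : EuclideanSpace ℝ (Fin 4)} (hy : y ≠ 0) :
    fderiv ℝ (radialExt f) y (frameCLM i y) = radialExt (along (frame i) f) y := by
  have hc : 0 < √2 / ‖y‖ := div_pos sqrt_two_pos (norm_pos_iff.2 hy)
  have hcy : (√2 / ‖y‖) • y ≠ 0 := smul_ne_zero hc.ne' hy
  have h1 : HasFDerivAt (fun v : EuclideanSpace ℝ (Fin 4) => (√2 / ‖y‖) • v)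
      ((√2 / ‖y‖) • ContinuousLinearMap.id ℝ (EuclideanSpace ℝ (Fin 4))) y :=
    ((√2 / ‖y‖) • ContinuousLinearMap.id ℝ (EuclideanSpace ℝ (Fin 4))).hasFDerivAt
  have h2 := (((hf.contDiffAt hcy).differentiableAt (by simp)).hasFDerivAt).comp y h1
  have h3 : radialExt f =ᶠ[nhds y] radialExt f ∘ fun v => (√2 / ‖y‖) • v := by
    filter_upwards [isOpen_compl_singleton.mem_nhds hy] with v hv
    exact (radialExt_pos_smul f hc hv).symm
  rw [h3.fderiv_eq, h2.fderiv, radialExt_apply sqrt_two_pos _ hy, along, frame_eq]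
  simp

end Homogeneous

/-- For `y ≠ 0` this is the expansion of `v` in the orthogonal basis `y, X₁(y), X₂(y), X₃(y)`; the
factor `2` reflects `‖Xᵢ(y)‖² = ‖y‖²/2`. -/
lemma norm_sq_smul_eq (y v : EuclideanSpace ℝ (Fin 4)) :
    ‖y‖ ^ 2 • v = ⟪y, v⟫ • y + ∑ i, (2 * ⟪frameCLM i y, v⟫) • frameCLM i y := by
  have h : (√2)⁻¹ ^ 2 = (1 / 2 : ℝ) := by rw [sq, inv_sqrt_two_mul_self]
  rw [EuclideanSpace.norm_sq_eq]
  ext j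
  fin_cases j <;>
    simp [Fin.sum_univ_three, Fin.sum_univ_four, frameCLM_zero_apply, frameCLM_one_apply,
      frameCLM_two_apply, PiLp.inner_apply] <;> ring_nf <;> simp only [h] <;> ring

lemma mulI_eq (y : EuclideanSpace ℝ (Fin 4)) : mulI y = √2 • frameCLM 0 y := by
  rw [frameCLM_zero_apply, smul_smul, mul_one_div_cancel sqrt_two_pos.ne', one_smul]
  rfl

lemma mulI_frameCLM_one (y : EuclideanSpace ℝ (Fin 4)) :
    mulI (frameCLM 1 y) = frameCLM 2 y := by
  ext j
  fin_cases j <;> simp [mulI, frameCLM_one_apply, frameCLM_two_apply]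

lemma mulI_frameCLM_two (y : EuclideanSpace ℝ (Fin 4)) :
    mulI (frameCLM 2 y) = -frameCLM 1 y := by
  ext j
  fin_cases j <;> simp [mulI, frameCLM_one_apply, frameCLM_two_apply]

/-- A real linear functional on `ℂ² = ℝ⁴` that is complex linear on the vectors `y`, `X₁(y)`,
`X₂(y)` and `X₃(y)` is complex linear. -/
lemma apply_mulI_of_frame (T : EuclideanSpace ℝ (Fin 4) →L[ℝ] ℂ) {y : EuclideanSpace ℝ (Fin 4)}
    (hy : y ≠ 0) (h0 : T (frameCLM 0 y) = Complex.I * (1 / √2 : ℝ) * T y)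
    (h1 : T (frameCLM 1 y) + Complex.I * T (frameCLM 2 y) = 0) (v : EuclideanSpace ℝ (Fin 4)) :
    T (mulI v) = Complex.I * T v := by
  have hs := ofReal_sqrt_two_mul_self
  have hs0 := ofReal_sqrt_two_ne_zero
  let S : EuclideanSpace ℝ (Fin 4) →L[ℝ] ℂ := √2 • (T ∘L frameCLM 0) - Complex.I • T
  have hS : ∀ v, S v = T (mulI v) - Complex.I * T v := fun v => by
    rw [mulI_eq, map_smul]
    rfl
  have hSy : S y = 0 := by
    rw [hS, mulI_eq, map_smul, h0, Complex.real_smul]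
    push_cast
    field_simp
    ring
  have hS0 : S (frameCLM 0 y) = 0 := by
    rw [hS, mulI_eq, frameCLM_sq, map_smul, map_neg, map_smul, h0, Complex.real_smul,
      Complex.real_smul]
    push_cast
    field_simp
    linear_combination -T y * hs - 2 * T y * Complex.I_sq
  have hS1 : S (frameCLM 1 y) = 0 := by
    rw [hS, mulI_frameCLM_one]
    linear_combination -Complex.I * h1 + T (frameCLM 2 y) * Complex.I_sq
  have hS2 : S (frameCLM 2 y) = 0 := by
    rw [hS, mulI_frameCLM_two, map_neg]
    linear_combination -h1
  have h3 : ‖y‖ ^ 2 • S v = 0 := by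
    rw [← map_smul, norm_sq_smul_eq y v, Fin.sum_univ_three]
    simp [hSy, hS0, hS1, hS2]
  have h4 := (smul_eq_zero.1 h3).resolve_left (by simpa using hy)
  rw [hS] at h4
  exact sub_eq_zero.1 h4

/-- The extension of `h` to a function on `ℂ² \ {0}` that is homogeneous of degree `k`. -/
def homExt (k : ℕ) (h : S3 → ℂ) (y : EuclideanSpace ℝ (Fin 4)) : ℂ :=
  (‖y‖ / √2) ^ k • radialExt h y

/-- Radially this is Euler's identity. The frame directions are tangent to the spheres about the
origin, so there the factor `‖y‖ ^ k` is not differentiated. -/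
lemma hasFDerivAt_homExt (k : ℕ) {h : S3 → ℂ} (hh : IsSmooth h) {y : EuclideanSpace ℝ (Fin 4)}
    (hy : y ≠ 0) :
    ∃ T : EuclideanSpace ℝ (Fin 4) →L[ℝ] ℂ, HasFDerivAt (homExt k h) T y ∧
      T y = k * homExt k h y ∧
      ∀ i, T (frameCLM i y) = homExt k (along (frame i) h) y := by
  have hn := norm_ne_zero_iff.2 hy
  have h1 : HasFDerivAt (fun y : EuclideanSpace ℝ (Fin 4) => ‖y‖) (fderiv ℝ (fun y => ‖y‖) y) y :=
    ((contDiffAt_norm ℝ (n := 1) hy).differentiableAt (by simp)).hasFDerivAt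
  have h2 : ∀ v, fderiv ℝ (fun y : EuclideanSpace ℝ (Fin 4) => ‖y‖) y v = ⟪y, v⟫ / ‖y‖ := by
    intro v
    have h3 := (h1.pow 2).unique (hasStrictFDerivAt_norm_sq y).hasFDerivAt
    have h4 := DFunLike.congr_fun h3 v
    simp at h4
    field_simp
    linarith
  have h5 := ((h1.mul_const ((√2)⁻¹)).pow k).smul
    ((hh.contDiffAt hy).differentiableAt (by simp)).hasFDerivAt
  refine ⟨_, h5, ?_, fun i => ?_⟩
  · have hk : (k : ℝ) * (‖y‖ * (√2)⁻¹) ^ (k - 1) * (‖y‖ * (√2)⁻¹) = k * (‖y‖ * (√2)⁻¹) ^ k := by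
      rcases k with _ | k
      · simp
      · rw [Nat.add_sub_cancel, pow_succ, mul_assoc]
    have hk' : (k : ℝ) * (‖y‖ * (√2)⁻¹) ^ (k - 1) * ((√2)⁻¹ * (⟪y, y⟫ / ‖y‖))
        = k * (‖y‖ * (√2)⁻¹) ^ k := by
      rw [← hk, real_inner_self_eq_norm_sq]
      field_simp
    simp [h2, fderiv_radialExt_self hh hy, homExt, div_eq_mul_inv] at hk' ⊢
    have hc := congrArg (fun c : ℝ => (c : ℂ)) hk'
    push_cast at hc
    rw [hc, mul_assoc]
  · have hi : ⟪y, frameCLM i y⟫ = 0 := by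
      fin_cases i <;> simp [PiLp.inner_apply, Fin.sum_univ_four, frameCLM_zero_apply,
        frameCLM_one_apply, frameCLM_two_apply] <;> ring
    simp [h2, fderiv_radialExt_frameCLM hh i hy, hi, homExt, div_eq_mul_inv]

/-! ### Restriction to an affine line -/

/-- The affine line `t ↦ (1, t)` in `ℂ²`. -/
def affineLine (t : ℂ) : EuclideanSpace ℝ (Fin 4) := !₂[1, 0, t.re, t.im]

lemma norm_sq_affineLine (t : ℂ) : ‖affineLine t‖ ^ 2 = 1 + ‖t‖ ^ 2 := by
  rw [EuclideanSpace.norm_sq_eq, Fin.sum_univ_four, Complex.sq_norm, Complex.normSq_apply]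
  simp [affineLine]
  ring

lemma affineLine_ne_zero (t : ℂ) : affineLine t ≠ 0 := by
  intro h
  have := norm_sq_affineLine t
  rw [h, norm_zero] at this
  nlinarith [norm_nonneg t]

lemma hasFDerivAt_affineLine (t : ℂ) : ∃ L : ℂ →L[ℝ] EuclideanSpace ℝ (Fin 4),
    HasFDerivAt affineLine L t ∧ L 1 = EuclideanSpace.single 2 1 ∧
      L Complex.I = EuclideanSpace.single 3 1 := by
  let L : ℂ →L[ℝ] EuclideanSpace ℝ (Fin 4) :=
    Complex.reCLM.smulRight (EuclideanSpace.single 2 1)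
      + Complex.imCLM.smulRight (EuclideanSpace.single 3 1)
  refine ⟨L, ?_, by simp [L], by simp [L]⟩
  refine (L.hasFDerivAt.const_add (EuclideanSpace.single 0 1)).congr_of_eventuallyEq
    (Filter.Eventually.of_forall fun s => ?_)
  ext j
  fin_cases j <;> simp [affineLine, L]

lemma mulI_single_two : mulI (EuclideanSpace.single 2 1) = EuclideanSpace.single 3 1 := by
  ext j
  fin_cases j <;> simp [mulI]

lemma raising_eq_zero_of_mem {k : ℕ} {h : ComplexFun} (hh : h ∈ weightSpace k k) :
    raising h = 0 := by
  have h1 := raising_mem hh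
  rwa [weightSpace_eq_bot_of_add_one_le (by linarith), Submodule.mem_bot] at h1

/-- The derivative is complex linear at each point of the line: on the plane of `y` and `X₁(y)`
because degree and weight are both `k`, on that of `X₂(y)` and `X₃(y)` because raising annihilates
`h`. -/
lemma differentiable_homExt_affineLine {k : ℕ} {h : ComplexFun} (hh : h ∈ weightSpace k k) :
    Differentiable ℂ fun t => homExt k h.1 (affineLine t) := by
  intro t
  obtain ⟨T, hT, hTy, hTi⟩ := hasFDerivAt_homExt k h.2 (affineLine_ne_zero t)
  obtain ⟨L, hL, hL1, hLI⟩ := hasFDerivAt_affineLine t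
  have h1 : HasFDerivAt (fun t => homExt k h.1 (affineLine t)) (T ∘L L) t := hT.comp t hL
  rw [differentiableAt_complex_iff_differentiableAt_real]
  refine ⟨h1.differentiableAt, ?_⟩
  rw [h1.fderiv]
  change T (L Complex.I) = Complex.I * T (L 1)
  rw [hL1, hLI, ← mulI_single_two]
  refine apply_mulI_of_frame T (affineLine_ne_zero t) ?_ ?_ _
  · have h2 : along (frame 0) h.1 = fun x => (Complex.I * ((k : ℝ) / √2 : ℝ)) * h.1 x :=
      congrArg Subtype.val (mem_weightSpace.1 hh).2
    rw [hTi, hTy, h2, homExt, homExt, radialExt_apply sqrt_two_pos _ (affineLine_ne_zero t),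
      radialExt_apply sqrt_two_pos _ (affineLine_ne_zero t), Complex.real_smul, Complex.real_smul]
    push_cast
    ring
  · have h2 := congrFun (congrArg Subtype.val (raising_eq_zero_of_mem hh))
    have h3 : ∀ x, along (frame 1) h.1 x + Complex.I * along (frame 2) h.1 x = 0 := h2
    rw [hTi, hTi, homExt, homExt, radialExt_apply sqrt_two_pos _ (affineLine_ne_zero t),
      radialExt_apply sqrt_two_pos _ (affineLine_ne_zero t), Complex.real_smul, Complex.real_smul]
    linear_combination (((‖affineLine t‖ / √2) ^ k : ℝ) : ℂ) *
      h3 ⟨_, proj_mem sqrt_two_pos (affineLine_ne_zero t)⟩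

/-- `h` is bounded on the compact sphere, so its extension grows at most like `‖y‖ ^ k`. -/
lemma exists_polynomial_homExt {k : ℕ} {h : ComplexFun} (hh : h ∈ weightSpace k k) :
    ∃ p : Polynomial ℂ, p.natDegree ≤ k ∧ ∀ t, homExt k h.1 (affineLine t) = p.eval t := by
  obtain ⟨C, hC⟩ := isCompact_univ.exists_bound_of_continuousOn h.2.continuous.continuousOn
  refine exists_polynomial_of_growth k (C := C) (differentiable_homExt_affineLine hh) fun t => ?_
  have hn : ‖affineLine t‖ / √2 ≤ 1 + ‖t‖ := by
    have h1 := norm_sq_affineLine t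
    have h2 : ‖affineLine t‖ ≤ 1 + ‖t‖ :=
      abs_le_of_sq_le_sq' (by nlinarith [norm_nonneg t]) (by positivity) |>.2
    have h3 : 1 ≤ √(2 : ℝ) := Real.one_le_sqrt.2 (by norm_num)
    exact (div_le_self (norm_nonneg _) h3).trans h2
  have hn0 : 0 ≤ ‖affineLine t‖ / √2 := by positivity
  rw [homExt, norm_smul, Real.norm_of_nonneg (pow_nonneg hn0 k), mul_comm,
    radialExt_apply sqrt_two_pos _ (affineLine_ne_zero t)]
  have h4 := hC ⟨_, proj_mem sqrt_two_pos (affineLine_ne_zero t)⟩ (Set.mem_univ _)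
  exact mul_le_mul h4 (pow_le_pow_left₀ hn0 hn k) (pow_nonneg hn0 k) ((norm_nonneg _).trans h4)

lemma homExt_binaryForm (k : ℕ) (a : Fin (k + 1) → ℂ) (t : ℂ) :
    homExt k (binaryForm k a).1.1 (affineLine t) = ∑ j, a j * t ^ (j : ℕ) := by
  have hn : (‖affineLine t‖ : ℂ) ≠ 0 :=
    Complex.ofReal_ne_zero.2 (norm_ne_zero_iff.2 (affineLine_ne_zero t))
  have hs := ofReal_sqrt_two_ne_zero
  rw [homExt, radialExt_apply sqrt_two_pos _ (affineLine_ne_zero t), binaryForm_apply,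
    Finset.smul_sum]
  refine Finset.sum_congr rfl fun j _ => ?_
  have hZ : coordZ (affineLine t) = 1 := by simp [coordZ_apply, affineLine]
  have hW : coordW (affineLine t) = t := by
    rw [coordW_apply, mul_comm]
    simp [affineLine, Complex.re_add_im]
  have hj : (k : ℕ) = (k - j) + j := (Nat.sub_add_cancel (Nat.lt_succ_iff.1 j.2)).symm
  rw [map_smul, map_smul, hZ, hW, Complex.real_smul, Complex.real_smul, Complex.real_smul,
    mul_pow, mul_pow]
  have h1 : (((‖affineLine t‖ / √2) ^ k : ℝ) : ℂ) * (((√2 / ‖affineLine t‖ : ℝ) : ℂ) ^ (k - j : ℕ)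
      * ((√2 / ‖affineLine t‖ : ℝ) : ℂ) ^ (j : ℕ)) = 1 := by
    rw [← pow_add, ← hj]
    push_cast
    rw [← mul_pow, div_mul_div_comm, mul_comm, div_self (mul_ne_zero hs hn), one_pow]
  linear_combination a j * t ^ (j : ℕ) * h1

lemma binaryForm_injective (k : ℕ) : Function.Injective (binaryForm k) := by
  rw [injective_iff_map_eq_zero]
  intro a ha
  have h1 : ∀ t : ℂ, ∑ j : Fin (k + 1), a j * t ^ (j : ℕ) = 0 := by
    intro t
    rw [← homExt_binaryForm, ha, homExt, radialExt_apply sqrt_two_pos _ (affineLine_ne_zero t)]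
    exact smul_zero _
  have h2 : ∑ j : Fin (k + 1), Polynomial.monomial (j : ℕ) (a j) = 0 := by
    refine Polynomial.funext fun t => ?_
    simpa [Polynomial.eval_finsetSum, Polynomial.eval_monomial] using h1 t
  funext i
  have h3 := congrArg (fun p => Polynomial.coeff p (i : ℕ)) h2
  simpa [Polynomial.finsetSum_coeff, Polynomial.coeff_monomial, Fin.val_inj] using h3

lemma apply_frameFlow_zero {k : ℕ} {m : ℝ} {h : ComplexFun} (hh : h ∈ weightSpace k m) (x : S3)
    (s : ℝ) : h.1 (frameFlow 0 x s) = Complex.exp (Complex.I * (m / √2 : ℝ) * s) * h.1 x := by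
  set c : ℂ := Complex.I * (m / √2 : ℝ) with hc
  have h0 : ∀ y, along (frame 0) h.1 y = c * h.1 y :=
    congrFun (congrArg Subtype.val (mem_weightSpace.1 hh).2)
  -- Along a fibre the weight condition is the linear ODE `u' = c u`; multiplying by the inverse
  -- exponential makes `u` constant.
  have h1 : ∀ s : ℝ,
      HasDerivAt (fun s : ℝ => Complex.exp (-(c * s)) * h.1 (frameFlow 0 x s)) 0 s := by
    intro s
    have h2 : HasDerivAt (fun s : ℝ => -(c * (s : ℂ))) (-c) s := by
      exact ((Complex.ofRealCLM.hasDerivAt (x := s)).const_mul c).neg.congr_deriv (by simp)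
    refine (h2.cexp.mul (hasDerivAt_comp_frameFlow h.2 0 x s)).congr_deriv ?_
    rw [h0]
    ring
  have h3 := is_const_of_deriv_eq_zero (fun s => (h1 s).differentiableAt) (fun s => (h1 s).deriv)
    s 0
  simp only [frameFlow_zero, Complex.ofReal_zero, mul_zero, neg_zero, Complex.exp_zero,
    one_mul] at h3
  rw [← h3, ← mul_assoc, ← Complex.exp_add, add_neg_cancel, Complex.exp_zero, one_mul]

lemma coordZ_frameFlow_zero (x : S3) (s : ℝ) :
    coordZ (frameFlow 0 x s) = Complex.exp (((s / √2 : ℝ) : ℂ) * Complex.I) * coordZ x := by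
  have h1 : √2 * Real.sin (s / √2) * (1 / √2) = Real.sin (s / √2) := by
    field_simp
  change coordZ (Real.cos (s / √2) • (x : EuclideanSpace ℝ (Fin 4))
    + (√2 * Real.sin (s / √2)) • frame 0 x) = _
  rw [map_add, map_smul, map_smul, frame_eq, coordZ_frameCLM_zero, Complex.real_smul,
    Complex.real_smul, Complex.exp_mul_I, ← Complex.ofReal_cos, ← Complex.ofReal_sin]
  have h2 := congrArg (fun c : ℝ => (c : ℂ)) h1
  simp only [Complex.ofReal_mul] at h2 ⊢
  linear_combination Complex.I * coordZ x * h2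

/-- A function of highest weight is determined by its homogeneous extension on an affine line. -/
lemma eq_zero_of_homExt_affineLine {k : ℕ} {h : ComplexFun} (hh : h ∈ weightSpace k k)
    (h0 : ∀ t, homExt k h.1 (affineLine t) = 0) : h = 0 := by
  have hline : ∀ t, radialExt h.1 (affineLine t) = 0 := fun t =>
    (smul_eq_zero.1 (h0 t)).resolve_left
      (pow_ne_zero _ (div_ne_zero (norm_ne_zero_iff.2 (affineLine_ne_zero t)) sqrt_two_pos.ne'))
  -- A point with `z = r > 0` lies on the ray through `(1, w/r)`, and the radial extension is
  -- constant on rays.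
  have hpos : ∀ (x : S3) (r : ℝ), 0 < r → coordZ x = r → h.1 x = 0 := by
    intro x r hr hx
    have h1 : (x : EuclideanSpace ℝ (Fin 4)) = r • affineLine (coordW x / r) := by
      have hr' : (r : ℂ) ≠ 0 := Complex.ofReal_ne_zero.2 hr.ne'
      rw [coordZ_apply] at hx
      have hre := congrArg Complex.re hx
      have him := congrArg Complex.im hx
      simp at hre him
      rw [coordW_apply]
      ext j
      fin_cases j <;> simp [affineLine, hre, him, Complex.div_ofReal_re, Complex.div_ofReal_im] <;>
        field_simp
    rw [← radialExt_coe sqrt_two_pos h.1 x, h1,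
      radialExt_pos_smul _ hr (affineLine_ne_zero _), hline]
  have hne : ∀ x : S3, coordZ x ≠ 0 → h.1 x = 0 := by
    intro x hx
    -- This time along the fibre turns `z` into `|z|`, while `h` only picks up a nonzero factor.
    have h1 := apply_frameFlow_zero hh x (√2 * -(coordZ x).arg)
    have h2 : √2 * -(coordZ x).arg / √2 = -(coordZ x).arg := by field_simp
    rw [hpos _ ‖coordZ x‖ (norm_pos_iff.2 hx)] at h1
    · exact (mul_eq_zero.1 h1.symm).resolve_left (Complex.exp_ne_zero _)
    · rw [coordZ_frameFlow_zero, h2]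
      nth_rw 2 [← Complex.norm_mul_exp_arg_mul_I (coordZ x)]
      rw [mul_left_comm, ← Complex.exp_add]
      push_cast
      rw [neg_mul, neg_add_cancel, Complex.exp_zero, mul_one]
  refine Subtype.ext (funext fun x => ?_)
  by_cases hx : coordZ x = 0
  · have hx0 := ne_zero_of_mem sqrt_two_pos x
    -- Points with `z = 0` are limits of points with `z = s ≠ 0`, so continuity finishes.
    have hc : ContinuousAt (fun s : ℝ => radialExt h.1
        ((x : EuclideanSpace ℝ (Fin 4)) + s • EuclideanSpace.single 0 1)) 0 := by
      refine ContinuousAt.comp (g := radialExt h.1) (f := fun s : ℝ =>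
        (x : EuclideanSpace ℝ (Fin 4)) + s • EuclideanSpace.single 0 1) ?_ (by fun_prop)
      simpa using (h.2.contDiffAt hx0).continuousAt
    have hz : (fun s : ℝ => radialExt h.1
        ((x : EuclideanSpace ℝ (Fin 4)) + s • EuclideanSpace.single 0 1))
        =ᶠ[nhdsWithin 0 {0}ᶜ] fun _ => 0 := by
      filter_upwards [self_mem_nhdsWithin] with s hs
      have hzs : coordZ ((x : EuclideanSpace ℝ (Fin 4)) + s • EuclideanSpace.single 0 1) = s := by
        rw [map_add, hx, zero_add, map_smul, coordZ_apply]
        simp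
      have hy : (x : EuclideanSpace ℝ (Fin 4)) + s • EuclideanSpace.single 0 1 ≠ 0 := by
        intro hy
        rw [hy, map_zero] at hzs
        exact hs (Complex.ofReal_eq_zero.1 hzs.symm)
      rw [radialExt_apply sqrt_two_pos _ hy]
      refine hne _ ?_
      change coordZ (_ • _) ≠ 0
      rw [map_smul, hzs]
      exact smul_ne_zero (div_ne_zero sqrt_two_pos.ne' (norm_ne_zero_iff.2 hy))
        (Complex.ofReal_ne_zero.2 hs)
    have hlim := tendsto_nhds_unique (hc.tendsto.mono_left nhdsWithin_le_nhds)
      (tendsto_const_nhds.congr' hz.symm)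
    rw [zero_smul, add_zero, radialExt_coe sqrt_two_pos] at hlim
    exact hlim
  · exact hne x hx

lemma homExt_sub (k : ℕ) (h g : S3 → ℂ) (y : EuclideanSpace ℝ (Fin 4)) :
    homExt k (h - g) y = homExt k h y - homExt k g y := by
  rw [homExt, homExt, homExt, sub_eq_add_neg h g, ← neg_one_smul ℝ g, radialExt_add,
    radialExt_smul, ← smul_sub]
  simp [sub_eq_add_neg]

lemma binaryForm_surjective (k : ℕ) : Function.Surjective (binaryForm k) := by
  rintro ⟨h, hh⟩
  obtain ⟨p, hp, hpg⟩ := exists_polynomial_homExt hh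
  -- The form with the coefficients of `p` agrees with `h` on the affine line; the degree bound
  -- ensures that the coefficients up to `k` are all of them.
  refine ⟨fun j => p.coeff j, Subtype.ext (sub_eq_zero.1 ?_).symm⟩
  refine eq_zero_of_homExt_affineLine (k := k)
    (Submodule.sub_mem _ hh (binaryForm k fun j => p.coeff j).2) fun t => ?_
  have h1 := homExt_sub k h.1 (binaryForm k fun j => p.coeff j).1.1 (affineLine t)
  rw [hpg, homExt_binaryForm, Polynomial.eval_eq_sum_range' (Nat.lt_succ_of_le hp),
    Finset.sum_range, sub_self] at h1
  exact h1

lemma finrank_weightSpace_self (k : ℕ) : Module.finrank ℂ (weightSpace k k) = k + 1 := by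
  rw [← (LinearEquiv.ofBijective (binaryForm k)
    ⟨binaryForm_injective k, binaryForm_surjective k⟩).finrank_eq]
  simp

lemma finrank_weightSpace {k : ℕ} {m : ℝ} (hm : weightSpace k m ≠ ⊥) :
    Module.finrank ℂ (weightSpace k m) = k + 1 := by
  rw [finrank_weightSpace_of_ne_bot hm, finrank_weightSpace_self]

/-! ### The eigenspaces of the Jacobi operator -/

lemma hasEigenvalue_restrict_iff {M : Type*} [AddCommGroup M] [Module ℝ M] (T : Module.End ℝ M)
    {p : Submodule ℝ M} (hT : ∀ v ∈ p, T v ∈ p) (μ : ℝ) :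
    Module.End.HasEigenvalue (M := p) (T.restrict hT) μ ↔ ∃ v ∈ p, v ≠ 0 ∧ T v = μ • v := by
  constructor
  · intro h
    obtain ⟨v, hv⟩ := h.exists_hasEigenvector
    exact ⟨v, v.2, fun h0 => hv.2 (Subtype.ext h0), congrArg Subtype.val hv.apply_eq_smul⟩
  · rintro ⟨v, hvp, hv0, hv⟩
    refine Module.End.hasEigenvalue_of_hasEigenvector (x := ⟨v, hvp⟩)
      ⟨Module.End.mem_eigenspace_iff.2 (Subtype.ext hv), fun h0 => hv0 (congrArg Subtype.val h0)⟩

lemma mem_lapEigenspace {k : ℕ} {f : SmoothFun} : f ∈ lapEigenspace k ↔ laplace f = lam k • f :=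
  Module.End.mem_eigenspace_iff

lemma deriveFrame_zero_mem {k : ℕ} {f : SmoothFun} (hf : f ∈ lapEigenspace k) :
    deriveFrame 0 f ∈ lapEigenspace k := by
  rw [mem_lapEigenspace] at hf ⊢
  rw [laplace_deriveFrame_zero, hf, map_smul]

lemma vertLaplace_mem {k : ℕ} {f : SmoothFun} (hf : f ∈ lapEigenspace k) :
    vertLaplace f ∈ lapEigenspace k := by
  rw [vertLaplace_eq]
  exact Submodule.neg_mem _ (deriveFrame_zero_mem (deriveFrame_zero_mem hf))

lemma mem_sectionSpace {k : ℕ} {V : Sections} : V ∈ sectionSpace k ↔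
    ∃ f ∈ lapEigenspace k, ∃ g ∈ lapEigenspace k, frameSection (f, g) = V := by
  simp only [sectionSpace, Submodule.mem_sup, Submodule.mem_map, frameSection_apply]
  constructor
  · rintro ⟨_, ⟨f, hf, rfl⟩, _, ⟨g, hg, rfl⟩, rfl⟩
    exact ⟨f, hf, g, hg, rfl⟩
  · rintro ⟨f, hf, g, hg, rfl⟩
    exact ⟨_, ⟨f, hf, rfl⟩, _, ⟨g, hg, rfl⟩, rfl⟩

lemma jacobi_frameSection_of_mem {k : ℕ} {f g : SmoothFun} (hf : f ∈ lapEigenspace k)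
    (hg : g ∈ lapEigenspace k) :
    jacobi (frameSection (f, g)) = frameSection
      (lam k • f - (2 * √2) • deriveFrame 0 g, lam k • g + (2 * √2) • deriveFrame 0 f) := by
  rw [jacobi_frameSection, mem_lapEigenspace.1 hf, mem_lapEigenspace.1 hg]

lemma jacobi_mem {k : ℕ} {V : Sections} (hV : V ∈ sectionSpace k) :
    jacobi V ∈ sectionSpace k := by
  obtain ⟨f, hf, g, hg, rfl⟩ := mem_sectionSpace.1 hV
  rw [jacobi_frameSection_of_mem hf hg]
  exact mem_sectionSpace.2 ⟨_, Submodule.sub_mem _ (Submodule.smul_mem _ _ hf)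
    (Submodule.smul_mem _ _ (deriveFrame_zero_mem hg)), _, Submodule.add_mem _
    (Submodule.smul_mem _ _ hg) (Submodule.smul_mem _ _ (deriveFrame_zero_mem hf)), rfl⟩

/-- After `λ_k` is subtracted, only `2√2 (-X₁g, X₁f)` remains. The real parameter `s` covers both
signs and the value zero at once. -/
lemma jacobi_frameSection_eq_smul_iff {k : ℕ} {f g : SmoothFun} (hf : f ∈ lapEigenspace k)
    (hg : g ∈ lapEigenspace k) (s : ℝ) :
    jacobi (frameSection (f, g)) = (lam k + 2 * √2 * s) • frameSection (f, g) ↔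
      deriveFrame 0 f = s • g ∧ deriveFrame 0 g = -(s • f) := by
  have hs : 2 * √2 ≠ 0 := mul_ne_zero two_ne_zero sqrt_two_pos.ne'
  rw [jacobi_frameSection_of_mem hf hg, ← map_smul frameSection, frameSection_injective.eq_iff]
  generalize 2 * √2 = c at hs ⊢
  have hneg : ∀ u v : SmoothFun, -(c • u) = c • v ↔ u = -v := fun u v => by
    rw [neg_eq_iff_eq_neg]
    refine ⟨fun h => smul_right_injective _ hs (h.trans (smul_neg c v).symm), fun h => ?_⟩
    rw [h]
    exact smul_neg c v
  rw [Prod.smul_mk, Prod.mk.injEq, add_smul, add_smul, sub_eq_add_neg, add_right_inj,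
    add_right_inj, mul_smul, mul_smul, hneg, smul_right_inj hs, and_comm]

/-- For `c < 0` the equation reads `X₁²f = -c f` with a positive factor, which the maximum principle
in the single direction `X₁` forbids. -/
lemma vertLaplace_nonneg {f : SmoothFun} (hf : f ≠ 0) {c : ℝ} (hc : vertLaplace f = c • f) :
    0 ≤ c := by
  by_contra! hneg
  refine hf (Subtype.ext (eq_zero_of_sum_along_frame_sq f.2 (s := {0}) (neg_pos.2 hneg)
    fun x => ?_))
  rw [vertLaplace_eq, neg_eq_iff_eq_neg] at hc
  rw [Finset.sum_singleton, neg_mul]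
  exact congrFun (congrArg Subtype.val hc) x

lemma jacobi_eq_smul_iff_of_ne_zero {k : ℕ} {s : ℝ} (hs : s ≠ 0) (V : Sections) :
    (V ∈ sectionSpace k ∧ jacobi V = (lam k + 2 * √2 * s) • V) ↔
      ∃ f ∈ lapEigenspace k, vertLaplace f = s ^ 2 • f ∧
        V = frameSection (f, s⁻¹ • deriveFrame 0 f) := by
  constructor
  · rintro ⟨hV, hJ⟩
    obtain ⟨f, hf, g, hg, rfl⟩ := mem_sectionSpace.1 hV
    obtain ⟨h1, h2⟩ := (jacobi_frameSection_eq_smul_iff hf hg s).1 hJ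
    refine ⟨f, hf, ?_, ?_⟩
    · rw [vertLaplace_eq, h1, map_smul, h2, smul_neg, neg_neg, smul_smul, sq]
    · rw [h1, inv_smul_smul₀ hs]
  · rintro ⟨f, hf, hV, rfl⟩
    have hg := Submodule.smul_mem _ s⁻¹ (deriveFrame_zero_mem hf)
    refine ⟨mem_sectionSpace.2 ⟨f, hf, _, hg, rfl⟩,
      (jacobi_frameSection_eq_smul_iff hf hg s).2 ⟨(smul_inv_smul₀ hs _).symm, ?_⟩⟩
    rw [vertLaplace_eq, neg_eq_iff_eq_neg] at hV
    rw [map_smul, hV, smul_neg, smul_smul, sq, inv_mul_cancel_left₀ hs]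

lemma jacobi_eq_lam_smul_iff {k : ℕ} (V : Sections) :
    (V ∈ sectionSpace k ∧ jacobi V = lam k • V) ↔
      ∃ f₂ ∈ lapEigenspace k, ∃ f₃ ∈ lapEigenspace k,
        deriveFrame 0 f₂ = 0 ∧ deriveFrame 0 f₃ = 0 ∧ V = frameSection (f₂, f₃) := by
  have h0 : lam k = lam k + 2 * √2 * 0 := by ring
  constructor
  · rintro ⟨hV, hJ⟩
    obtain ⟨f, hf, g, hg, rfl⟩ := mem_sectionSpace.1 hV
    rw [h0, jacobi_frameSection_eq_smul_iff hf hg 0, zero_smul, zero_smul, neg_zero] at hJ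
    exact ⟨f, hf, g, hg, hJ.1, hJ.2, rfl⟩
  · rintro ⟨f, hf, g, hg, h1, h2, rfl⟩
    refine ⟨mem_sectionSpace.2 ⟨f, hf, g, hg, rfl⟩, ?_⟩
    rw [h0, jacobi_frameSection_eq_smul_iff hf hg 0, zero_smul, zero_smul, neg_zero]
    exact ⟨h1, h2⟩

lemma two_mul_sqrt_two_mul (c : ℝ) : 2 * √(2 * c) = 2 * √2 * √c := by
  rw [Real.sqrt_mul (by norm_num), mul_assoc]

lemma exists_jacobi_eigenvector_iff (k : ℕ) (μ : ℝ) :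
    (∃ V ∈ sectionSpace k, V ≠ 0 ∧ jacobi V = μ • V) ↔
      ∃ c : ℝ, (∃ f ∈ lapEigenspace k, f ≠ 0 ∧ vertLaplace f = c • f) ∧
        (μ = lam k + 2 * √(2 * c) ∨ μ = lam k - 2 * √(2 * c)) := by
  constructor
  · rintro ⟨V, hV, hV0, hJ⟩
    obtain ⟨f, hf, g, hg, rfl⟩ := mem_sectionSpace.1 hV
    obtain ⟨s, rfl⟩ : ∃ s, μ = lam k + 2 * √2 * s := by
      refine ⟨(μ - lam k) / (2 * √2), ?_⟩
      field_simp
      ring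
    obtain ⟨h1, h2⟩ := (jacobi_frameSection_eq_smul_iff hf hg s).1 hJ
    refine ⟨s ^ 2, ?_, ?_⟩
    · by_cases hf0 : f = 0
      · refine ⟨g, hg, fun hg0 => hV0 ?_, ?_⟩
        · rw [hf0, hg0]
          exact map_zero frameSection
        · rw [vertLaplace_eq, h2, map_neg, map_smul, h1, neg_neg, smul_smul, sq]
      · refine ⟨f, hf, hf0, ?_⟩
        rw [vertLaplace_eq, h1, map_smul, h2, smul_neg, neg_neg, smul_smul, sq]
    · rw [two_mul_sqrt_two_mul, Real.sqrt_sq_eq_abs]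
      rcases abs_choice s with h | h
      · exact Or.inl (by rw [h])
      · exact Or.inr (by rw [h]; ring)
  · rintro ⟨c, ⟨f, hf, hf0, hc⟩, hμ⟩
    have hc0 := vertLaplace_nonneg hf0 hc
    rcases hc0.eq_or_lt with rfl | hpos
    · have hμ' : μ = lam k := by simpa using hμ
      -- For `c = 0` the hypothesis only says `X₁²f = 0`. Either `X₁f = 0` and `u = f` serves, or `u
      -- = X₁f` does.
      have key : ∀ u ∈ lapEigenspace k, u ≠ 0 → deriveFrame 0 u = 0 →
          ∃ V ∈ sectionSpace k, V ≠ 0 ∧ jacobi V = μ • V := by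
        intro u hu hu0 hdu
        obtain ⟨h1, h2⟩ := (jacobi_eq_lam_smul_iff (frameSection (u, 0))).2
          ⟨u, hu, 0, Submodule.zero_mem _, hdu, map_zero _, rfl⟩
        refine ⟨_, h1, fun h3 => hu0 ?_, by rw [h2, hμ']⟩
        exact congrArg Prod.fst (frameSection_injective (h3.trans (map_zero frameSection).symm))
      by_cases hd : deriveFrame 0 f = 0
      · exact key f hf hf0 hd
      · refine key _ (deriveFrame_zero_mem hf) hd ?_
        rwa [vertLaplace_eq, zero_smul, neg_eq_zero] at hc
    · obtain ⟨s, hs, hsc, hμs⟩ : ∃ s : ℝ, s ≠ 0 ∧ s ^ 2 = c ∧ μ = lam k + 2 * √2 * s := by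
        have hsq := Real.sq_sqrt hc0
        have hne := (Real.sqrt_pos.2 hpos).ne'
        rw [two_mul_sqrt_two_mul] at hμ
        rcases hμ with h | h
        · exact ⟨√c, hne, hsq, h⟩
        · exact ⟨-√c, neg_ne_zero.2 hne, by rw [neg_sq, hsq], by rw [h]; ring⟩
      obtain ⟨h1, h2⟩ := (jacobi_eq_smul_iff_of_ne_zero (k := k) hs _).2
        ⟨f, hf, by rw [hsc, hc], rfl⟩
      refine ⟨_, h1, fun h3 => hf0 ?_, by rw [h2, hμs]⟩
      exact congrArg Prod.fst (frameSection_injective (h3.trans (map_zero frameSection).symm))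

/-! ### Multiplicities -/

lemma isSmooth_mk {f g : S3 → ℝ} (hf : IsSmooth f) (hg : IsSmooth g) :
    IsSmooth (fun x => (⟨f x, g x⟩ : ℂ)) := by
  convert (hf.clm_comp Complex.ofRealCLM).add (hg.clm_comp (Complex.I • Complex.ofRealCLM)) using 1
  funext x
  apply Complex.ext <;> simp

/-- Pairs of real functions as complex functions. -/
def toComplex : (SmoothFun × SmoothFun) ≃ₗ[ℝ] ComplexFun where
  toFun p := ⟨fun x => ⟨p.1.1 x, p.2.1 x⟩,
    isSmooth_mk p.1.2 p.2.2⟩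
  map_add' p q := rfl
  map_smul' c p := Subtype.ext (funext fun x => by
    apply Complex.ext <;> simp)
  invFun h := (⟨fun x => (h.1 x).re, h.2.clm_comp Complex.reCLM⟩,
    ⟨fun x => (h.1 x).im, h.2.clm_comp Complex.imCLM⟩)
  left_inv p := rfl
  right_inv h := rfl

lemma complexDeriv_toComplex (i : Fin 3) (f g : SmoothFun) :
    complexDeriv i (toComplex (f, g)) = toComplex (deriveFrame i f, deriveFrame i g) := by
  have h1 := along_clm_comp Complex.reCLM (toComplex (f, g)).2 (frame i)
  have h2 := along_clm_comp Complex.imCLM (toComplex (f, g)).2 (frame i)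
  refine Subtype.ext (funext fun x => Complex.ext ?_ ?_)
  · exact (congrFun h1 x).symm
  · exact (congrFun h2 x).symm

lemma complexLaplace_toComplex (f g : SmoothFun) :
    complexLaplace (toComplex (f, g)) = toComplex (laplace f, laplace g) := by
  rw [complexLaplace_apply, laplace_eq, laplace_eq]
  simp only [complexDeriv_toComplex]
  rw [← map_add, ← map_add, ← map_neg]
  rfl

lemma I_mul_smul_toComplex (a : ℝ) (f g : SmoothFun) :
    (Complex.I * (a : ℂ)) • toComplex (f, g) = toComplex (-(a • g), a • f) := by
  refine Subtype.ext (funext fun x => Complex.ext ?_ ?_)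
  · change ((Complex.I * (a : ℂ)) * ⟨f.1 x, g.1 x⟩).re = -(a * g.1 x)
    simp
  · change ((Complex.I * (a : ℂ)) * ⟨f.1 x, g.1 x⟩).im = a * f.1 x
    simp

lemma ofReal_smul_toComplex (a : ℝ) (p : SmoothFun × SmoothFun) :
    (a : ℂ) • toComplex p = toComplex (a • p) := by
  rw [map_smul]
  exact Subtype.ext (funext fun x => Complex.coe_smul _ _)

/-- The two real equations are the real and imaginary parts of `X₁(f + ig) = -is (f + ig)`, and
`im/√2 = -is` for `m = -√2 s`. -/
lemma toComplex_mem_weightSpace_iff {k : ℕ} (s : ℝ) (f g : SmoothFun) :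
    toComplex (f, g) ∈ weightSpace k (-(√2 * s)) ↔ (f ∈ lapEigenspace k ∧ g ∈ lapEigenspace k) ∧
      deriveFrame 0 f = s • g ∧ deriveFrame 0 g = -(s • f) := by
  have hn : ∀ u : SmoothFun, (-s) • u = -(s • u) := fun u => neg_smul s u
  have hs : -(√2 * s) / √2 = -s := by
    field_simp
  rw [mem_weightSpace, complexLaplace_toComplex, complexDeriv_toComplex, ofReal_smul_toComplex, hs,
    I_mul_smul_toComplex, toComplex.injective.eq_iff, toComplex.injective.eq_iff, Prod.smul_mk,
    Prod.mk.injEq, Prod.mk.injEq, mem_lapEigenspace, mem_lapEigenspace, hn, hn, neg_neg]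

/-- The eigenspace is identified over `ℝ` with the weight space of weight `-√2 s`. That `μ` is an
eigenvalue makes this space nonzero, hence of complex dimension `k + 1`. -/
lemma finrank_jacobi_eigenspace {k : ℕ} (hJ : ∀ V ∈ sectionSpace k, jacobi V ∈ sectionSpace k)
    {μ : ℝ} (hμ : Module.End.HasEigenvalue (M := sectionSpace k) (jacobi.restrict hJ) μ) :
    Module.finrank ℝ (Module.End.eigenspace (M := sectionSpace k) (jacobi.restrict hJ) μ)
      = 2 * (k + 1) := by
  obtain ⟨s, rfl⟩ : ∃ s, μ = lam k + 2 * √2 * s := by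
    refine ⟨(μ - lam k) / (2 * √2), ?_⟩
    field_simp
    ring
  have hmap : (Module.End.eigenspace (M := sectionSpace k) (jacobi.restrict hJ)
      (lam k + 2 * √2 * s)).map (sectionSpace k).subtype
      = (((weightSpace k (-(√2 * s))).restrictScalars ℝ).map
          (toComplex.symm : ComplexFun →ₗ[ℝ] SmoothFun × SmoothFun)).map frameSection := by
    ext V
    simp only [Submodule.mem_map, Module.End.mem_eigenspace_iff]
    constructor
    · rintro ⟨⟨V, hV⟩, hVJ, rfl⟩
      obtain ⟨f, hf, g, hg, rfl⟩ := mem_sectionSpace.1 hV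
      refine ⟨(f, g), ⟨toComplex (f, g), ?_, toComplex.symm_apply_apply _⟩, rfl⟩
      exact (toComplex_mem_weightSpace_iff s f g).2 ⟨⟨hf, hg⟩,
        (jacobi_frameSection_eq_smul_iff hf hg s).1 (congrArg Subtype.val hVJ)⟩
    · rintro ⟨⟨f, g⟩, ⟨h, hh, hfg⟩, rfl⟩
      have h1 : toComplex (f, g) = h := by
        rw [← hfg]
        exact toComplex.apply_symm_apply h
      obtain ⟨⟨hf, hg⟩, h2⟩ := (toComplex_mem_weightSpace_iff s f g).1 (h1 ▸ hh)
      exact ⟨⟨_, mem_sectionSpace.2 ⟨f, hf, g, hg, rfl⟩⟩,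
        Subtype.ext ((jacobi_frameSection_eq_smul_iff hf hg s).2 h2), rfl⟩
  have hrank : Module.finrank ℝ (Module.End.eigenspace (M := sectionSpace k) (jacobi.restrict hJ)
      (lam k + 2 * √2 * s)) = Module.finrank ℝ (weightSpace k (-(√2 * s))) := by
    rw [← Submodule.finrank_map_subtype_eq, hmap]
    exact (((Submodule.equivMapOfInjective _ toComplex.symm.injective _).trans
      (Submodule.equivMapOfInjective _ frameSection_injective _)).finrank_eq).symm
  have hne : weightSpace k (-(√2 * s)) ≠ ⊥ := by
    intro hbot
    obtain ⟨V, hV, hV0, hVJ⟩ := (hasEigenvalue_restrict_iff jacobi hJ _).1 hμ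
    obtain ⟨f, hf, g, hg, rfl⟩ := mem_sectionSpace.1 hV
    have h1 := (toComplex_mem_weightSpace_iff s f g).2 ⟨⟨hf, hg⟩,
      (jacobi_frameSection_eq_smul_iff hf hg s).1 hVJ⟩
    rw [hbot, Submodule.mem_bot, LinearEquiv.map_eq_zero_iff] at h1
    exact hV0 (by rw [h1, map_zero])
  refine hrank.trans ((finrank_real_of_complex (weightSpace k (-(√2 * s)))).trans ?_)
  rw [finrank_weightSpace hne]

end HopfJacobi

end

open HopfJacobi Module.End in
theorem proposition4p3 (k : ℕ) :
    ∃ (hV : ∀ f ∈ lapEigenspace k, vertLaplace f ∈ lapEigenspace k)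
      (hJ : ∀ V ∈ sectionSpace k, jacobi V ∈ sectionSpace k),
      (∀ c : ℝ, HasEigenvalue (M := lapEigenspace k) (vertLaplace.restrict hV) c → 0 ≤ c) ∧
      (∀ μ : ℝ, HasEigenvalue (M := sectionSpace k) (jacobi.restrict hJ) μ ↔
        ∃ c : ℝ, HasEigenvalue (M := lapEigenspace k) (vertLaplace.restrict hV) c ∧
          (μ = lam k + 2 * √(2 * c) ∨ μ = lam k - 2 * √(2 * c))) ∧
      (∀ V : Sections, (V ∈ sectionSpace k ∧ jacobi V = lam k • V) ↔
        ∃ f₂ ∈ lapEigenspace k, ∃ f₃ ∈ lapEigenspace k,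
          deriveFrame 0 f₂ = 0 ∧ deriveFrame 0 f₃ = 0 ∧
          V = mulSection (dHopfFrame 1) f₂ + mulSection (dHopfFrame 2) f₃) ∧
      (∀ c : ℝ, 0 < c → ∀ V : Sections,
        ((V ∈ sectionSpace k ∧ jacobi V = (lam k + 2 * √(2 * c)) • V) ↔
          ∃ f ∈ lapEigenspace k, vertLaplace f = c • f ∧
            V = mulSection (dHopfFrame 1) f
              + mulSection (dHopfFrame 2) ((1 / √c) • deriveFrame 0 f)) ∧
        ((V ∈ sectionSpace k ∧ jacobi V = (lam k - 2 * √(2 * c)) • V) ↔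
          ∃ f ∈ lapEigenspace k, vertLaplace f = c • f ∧
            V = mulSection (dHopfFrame 1) f
              - mulSection (dHopfFrame 2) ((1 / √c) • deriveFrame 0 f))) ∧
      (∀ μ : ℝ, HasEigenvalue (M := sectionSpace k) (jacobi.restrict hJ) μ →
        Module.finrank ℝ
          (eigenspace (M := sectionSpace k) (jacobi.restrict hJ) μ) = 2 * (k + 1)) := by
  refine ⟨fun f hf => vertLaplace_mem hf, fun V hV => jacobi_mem hV, fun c hc => ?_, fun μ => ?_,
    jacobi_eq_lam_smul_iff, fun c hc V => ⟨?_, ?_⟩, fun μ hμ => finrank_jacobi_eigenspace _ hμ⟩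
  · obtain ⟨f, -, hf, hfc⟩ := (hasEigenvalue_restrict_iff vertLaplace _ c).1 hc
    exact vertLaplace_nonneg hf hfc
  · simp only [hasEigenvalue_restrict_iff]
    exact exists_jacobi_eigenvector_iff k μ
  · have h := jacobi_eq_smul_iff_of_ne_zero (k := k) (Real.sqrt_pos.2 hc).ne' V
    rwa [Real.sq_sqrt hc.le, ← two_mul_sqrt_two_mul, ← one_div] at h
  -- The minus sign is the case `s = -√c` of the same criterion.
  · have h := jacobi_eq_smul_iff_of_ne_zero (k := k) (neg_ne_zero.2 (Real.sqrt_pos.2 hc).ne') V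
    rw [neg_sq, Real.sq_sqrt hc.le, mul_neg, ← sub_eq_add_neg, ← two_mul_sqrt_two_mul] at h
    have hV : ∀ f, frameSection (f, (-√c)⁻¹ • deriveFrame 0 f) = mulSection (dHopfFrame 1) f
        - mulSection (dHopfFrame 2) ((1 / √c) • deriveFrame 0 f) := fun f => by
      have hn : (-√c)⁻¹ • deriveFrame 0 f = -((1 / √c) • deriveFrame 0 f) := by
        rw [inv_neg, one_div]
        exact neg_smul (√c)⁻¹ (deriveFrame 0 f)
      rw [frameSection_apply, hn, map_neg, ← sub_eq_add_neg]
    simpa only [hV] using h
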